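/- Let $p\le n$ and give $\mathbb R^n$ and $\mathbb R^p$ the Euclidean norm $|\cdot|$ and the Borel $\sigma$-algebra. Let $f:\mathbb R^n\to\mathbb R^n$, $h:\mathbb R^n\to\mathbb R^p$, and on a probability space $(\Omega,\mathcal F,\mathbb P)$ let $$X_k=f(X_{k-1})+\zeta_k\quad(k\ge 1),\qquad Y_k=h(X_k)+\varepsilon_k\quad(k\ge 0),$$ where $X_0$ is an arbitrary random variable, $(\zeta_k)_{k\ge0}$ is i.i.d. with an everywhere positive Lebesgue density $\gamma$ on $\mathbb R^n$, $(\varepsilon_k)_{k\ge0}$ is i.i.d. with an everywhere positive Lebesgue density $v$ on $\mathbb R^p$, and the sequences $(\zeta_k)$ and $(\varepsilon_k)$ are independent of each other. Let $Q(x,A)=\int_A\gamma(x'-f(x))\,dx'$ and $g(x,y)=v(y-h(x))$, and for a probability measure $\nu$ on $\mathbb R^n$ let $\phi_{\nu,m}[y_{0:m}]$ be the filtering distribution $$\phi_{\nu,m}[y_{0:m}](A)=\frac{\int\nu(dx_0)g(x_0,y_0)\prod_{i=1}^mQ(x_{i-1},dx_i)g(x_i,y_i)\,\mathbf 1_A(x_m)}{\int\nu(dx_0)g(x_0,y_0)\prod_{i=1}^mQ(x_{i-1},dx_i)g(x_i,y_i)}.$$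 Assume: (E1) there are constants $a,b_0,b\ge0$ such that $f$ is $a$-Lipschitz, $h$ is uniformly continuous and surjective, and $|x_1-x_2|\le b_0+b\,|h(x_1)-h(x_2)|$ for all $x_1,x_2\in\mathbb R^n$; (E2) $v$ is bounded, $\lim_{|u|\to\infty}v(u)=0$, and $\inf_Kv>0$ for every nonempty compact $K\subset\mathbb R^p$; (E3) for every $\Delta>0$, $\mathbb E|Z_1^\Delta|<\infty$, where, with $\gamma^-(r)=\inf_{|s|\le r}\gamma(s)$, $$Z_1^\Delta=-\log\gamma^-\bigl(2(a+1)b_0+(a+1)b\Delta+ab|\varepsilon_0|+|\zeta_1|+b|\varepsilon_1|\bigr)$$ (equal to $+\infty$ where $\gamma^-$ vanishes). For $y\in\mathbb R^p$ and $\Delta>0$ let $C(y,\Delta)=\{x\in\mathbb R^n:|h(x)-y|\le\Delta\}$. Then for all probability measures $\nu,\nu'$ on $\mathbb R^n$ and all $\Delta>0$ such that, $\mathbb P$-almost surely, $\nu Q\mathbf 1_{C(Y_1,\Delta)}=\int Q(x,C(Y_1,\Delta))\,\nu(dx)>0$ and $\nu'Q\mathbf 1_{C(Y_1,\Delta)}>0$,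 we have $$\limsup_{m\to\infty}\frac1m\log\bigl\|\phi_{\nu,m}[Y_{0:m}]-\phi_{\nu',m}[Y_{0:m}]\bigr\|_{\mathrm{TV}}<0\qquad\mathbb P\text{-almost surely},$$ where $\|\mu-\mu'\|_{\mathrm{TV}}=\sup_A|\mu(A)-\mu'(A)|$ and $\log0=-\infty$. -/

import Mathlib

open MeasureTheory ProbabilityTheory Filter Topology
open scoped ENNReal NNReal

namespace HMMFilter

section General

variable {X Y : Type*} [MeasurableSpace X]

/-- The unnormalised filter `A ↦ ν[g(·, y₀) Q g(·, y₁) Q ⋯ Q g(·, yₙ) 1_A]` of a hidden Markov model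
with state transition kernel `Q` and likelihood `g`, started from `ν`. It is the measure
`A ↦ ∫ ν(dx₀) g(x₀, y₀) ∏_{i=1}^n Q(x_{i-1}, dx_i) g(x_i, y_i) 1_A(x_n)` and depends on
`y₀, …, yₙ` only. -/
noncomputable def unnormFilter (Q : Kernel X X) (g : X → Y → ℝ≥0∞) (ν : Measure X) (y : ℕ → Y) :
    ℕ → Measure X
  | 0 => ν.withDensity (fun x => g x (y 0))
  | n + 1 => ((unnormFilter Q g ν y n).bind Q).withDensity (fun x => g x (y (n + 1)))

/-- The filtering distribution `φ_{ν,n}[y_{0:n}]`: the unnormalised filter divided by its mass. -/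
noncomputable def filterDist (Q : Kernel X X) (g : X → Y → ℝ≥0∞) (ν : Measure X) (y : ℕ → Y)
    (n : ℕ) : Measure X :=
  (unnormFilter Q g ν y n Set.univ)⁻¹ • unnormFilter Q g ν y n

/-- Total variation distance `sup_A |μ(A) - μ'(A)|`, over measurable sets `A`, of two finite
measures. -/
noncomputable def tvDist (μ μ' : Measure X) : ℝ≥0∞ :=
  ⨆ (A : Set X) (_ : MeasurableSet A), ENNReal.ofReal |μ.real A - μ'.real A|

end General

/-- `ℝᵈ` with its Euclidean norm, Borel σ-algebra and Lebesgue measure. -/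
abbrev E (d : ℕ) : Type := EuclideanSpace ℝ (Fin d)

/-- `u` is an everywhere positive probability density with respect to Lebesgue measure on `ℝᵈ`. -/
structure IsPositiveDensity {d : ℕ} (u : E d → ℝ) : Prop where
  measurable : Measurable u
  pos : ∀ x, 0 < u x
  lintegral_eq_one : ∫⁻ x, ENNReal.ofReal (u x) = 1

/-- `(ζ_k)` is a sequence of i.i.d. random variables with density `u`. -/
structure IsIIDWithDensity {Ω : Type*} [MeasurableSpace Ω] (P : Measure Ω) {d : ℕ}
    (ζ : ℕ → Ω → E d) (u : E d → ℝ) : Prop where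
  measurable : ∀ k, Measurable (ζ k)
  law : ∀ k, P.map (ζ k) = (volume : Measure (E d)).withDensity (fun x => ENNReal.ofReal (u x))
  indep : iIndepFun ζ P

/-- The nonlinear state-space model with i.i.d. state noise: `X_k = f(X_{k-1}) + ζ_k` for `k ≥ 1`,
`Y_k = h(X_k) + ε_k` for `k ≥ 0`, where `ζ` and `ε` are i.i.d. sequences with positive densities
`γ` and `v`, independent of each other; `X_0` is any random variable. -/
structure IsStateSpaceModel {Ω : Type*} [MeasurableSpace Ω] (P : Measure Ω) {n p : ℕ}
    (f : E n → E n) (h : E n → E p) (γ : E n → ℝ) (v : E p → ℝ)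
    (ζ : ℕ → Ω → E n) (ε : ℕ → Ω → E p) (X : ℕ → Ω → E n) (Y : ℕ → Ω → E p) : Prop where
  stateDensity : IsPositiveDensity γ
  obsDensity : IsPositiveDensity v
  stateNoise : IsIIDWithDensity P ζ γ
  obsNoise : IsIIDWithDensity P ε v
  indep_noises : IndepFun (fun ω k => ζ k ω) (fun ω k => ε k ω) P
  measurable_init : Measurable (X 0)
  state_eq : ∀ k ω, X (k + 1) ω = f (X k ω) + ζ (k + 1) ω
  obs_eq : ∀ k ω, Y k ω = h (X k ω) + ε k ω

/-- `f` is `a`-Lipschitz, `h` is uniformly continuous and onto, and the distance of two states is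
at most `b₀ + b |y₁ - y₂|`, where `y₁`, `y₂` are their images under `h`. -/
structure ConditionE1 {n p : ℕ} (f : E n → E n) (h : E n → E p) (a b₀ b : ℝ≥0) : Prop where
  lipschitz : LipschitzWith a f
  uniformContinuous : UniformContinuous h
  surjective : Function.Surjective h
  dist_preimages : ∀ (y₁ y₂ : E p) (x₁ x₂ : E n), h x₁ = y₁ → h x₂ = y₂ →
    ‖x₁ - x₂‖ ≤ b₀ + b * ‖y₁ - y₂‖

/-- `v` is bounded, tends to `0` at infinity, and is bounded away from `0` on compact sets. -/
structure ConditionE2 {p : ℕ} (v : E p → ℝ) : Prop where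
  bounded : ∃ M : ℝ, ∀ u, v u ≤ M
  tendsto_zero : Tendsto v (cocompact (E p)) (𝓝 0)
  pos_on_compact : ∀ K : Set (E p), IsCompact K → ∃ c : ℝ, 0 < c ∧ ∀ u ∈ K, c ≤ v u

/-- The state transition kernel `Q(x, A) = ∫_A γ(x' - f(x)) dx'` (`γ` and `f` measurable). -/
noncomputable def transition {n : ℕ} (f : E n → E n) (γ : E n → ℝ) : Kernel (E n) (E n) :=
  Kernel.withDensity (Kernel.const (E n) (volume : Measure (E n)))
    (fun x x' => ENNReal.ofReal (γ (x' - f x)))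

/-- The likelihood `g(x, y) = v(y - h(x))`. -/
noncomputable def likelihood {n p : ℕ} (h : E n → E p) (v : E p → ℝ) (x : E n) (y : E p) : ℝ≥0∞ :=
  ENNReal.ofReal (v (y - h x))

/-- `C(y, Δ) = {x : |h(x) - y| ≤ Δ}`. -/
def ldSet {n p : ℕ} (h : E n → E p) (y : E p) (Δ : ℝ) : Set (E n) :=
  {x | ‖h x - y‖ ≤ Δ}

/-- `γ⁻(r) = inf_{|s| ≤ r} γ(s)`. -/
noncomputable def gammaMinus {n : ℕ} (γ : E n → ℝ) (r : ℝ) : ℝ≥0∞ :=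
  ⨅ (s : E n) (_ : ‖s‖ ≤ r), ENNReal.ofReal (γ s)

/-- `Z_k^Δ = -log γ⁻(2(a+1)b₀ + (a+1)bΔ + ab|ε_{k-1}| + |ζ_k| + b|ε_k|)` for `k ≥ 1`, with value
`+∞` where the infimum vanishes. -/
noncomputable def zVar {Ω : Type*} {n p : ℕ} (γ : E n → ℝ) (a b₀ b : ℝ≥0)
    (ζ : ℕ → Ω → E n) (ε : ℕ → Ω → E p) (Δ : ℝ) (k : ℕ) (ω : Ω) : EReal :=
  -ENNReal.log (gammaMinus γ
    (2 * (a + 1) * b₀ + (a + 1) * b * Δ + a * b * ‖ε (k - 1) ω‖ + ‖ζ k ω‖ + b * ‖ε k ω‖))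

end HMMFilter

/-!
Let `μ` and `μ'` be the unnormalised filters started from `ν` and `ν'`. The product `μ ⊗ μ'` evolves
by a kernel on pairs with density `q(x, z) q(x', z') g(z) g(z')`. Split off from this
kernel a minorant that is symmetric in the new pair `(z, z')`. Mass moved by the minorant
becomes symmetric and stays so, hence contributes nothing to `μ(A) μ'(X) - μ(X) μ'(A)`
(`exists_symmetric_add_pushSeq`, `tvDist_normalize_le`). The distance of the filters at time `m` is
therefore at most the mass that is never moved by the minorant, divided by the total mass.

A transition of the pair is good if both states go from `C(y_k, Δ')` to `C(y_{k+1}, Δ')` and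
`q(x, z) q(x', z') ≤ M ^ 2`. If in addition `q ≥ e` between these two sets, the minorant takes at
least the fraction `(e / M) ^ 2` of a good transition. Bad transitions are rare compared to the
decay of the total mass: off `C(y, Δ')` the likelihood is small, since `v` vanishes at infinity, and
the event `q > M` has small probability, since `γ` is integrable; no bound on `γ` is needed.
Giving every bad transition the weight `θ⁻¹` makes this quantitative (`pushSeq_le_good_add_bad`,
`lintegral_weighted_mul_penalty_le`): after `m` steps the trajectories with more than `m / 4` bad
transitions have mass at most `θ ^ (m / 4) * (4 * V ^ 2) ^ m` up to a constant, where `V` bounds the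
likelihood, while the others have been reduced by `ρ ^ (m / 4)`, `ρ < 1`, if half of the times
are helpful.

Both the exponential lower bound of the total mass (`exists_le_unnormFilter`, with the given `Δ`)
and the frequency of helpful times (`le_two_mul_count_of_sum_le`, with `Δ'`) follow from the law of
large numbers for `|Z_k|` (`exists_sum_zVar_le`), because `q ≥ exp (-|Z_k|)` from `C(Y_{k-1}, Δ)` to
`C(Y_k, Δ)`. The constants are chosen in the order: decay rate of the mass, `θ`, `Δ'` and `M`, `e`.
-/

namespace HMMFilter

/-! ### Pushing measures forward by transition densities -/

section Push

variable {S : Type*} [MeasurableSpace S] {vol : Measure S}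

/-- The image of `π` under the (not necessarily Markov) kernel `x ↦ k x z vol(dz)`. -/
noncomputable def push (vol : Measure S) (k : S → S → ℝ≥0∞) (π : Measure S) : Measure S :=
  vol.withDensity fun z => ∫⁻ x, k x z ∂π

/-- The measures obtained from `π` by pushing forward successively by `k 0, k 1, …`. -/
noncomputable def pushSeq (vol : Measure S) (k : ℕ → S → S → ℝ≥0∞) (π : Measure S) :
    ℕ → Measure S
  | 0 => π
  | n + 1 => push vol (k n) (pushSeq vol k π n)

instance [SFinite vol] (k : S → S → ℝ≥0∞) (π : Measure S) : SFinite (push vol k π) := by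
  unfold push; infer_instance

instance [SFinite vol] (k : ℕ → S → S → ℝ≥0∞) (π : Measure S) [SFinite π] (n : ℕ) :
    SFinite (pushSeq vol k π n) := by
  cases n with
  | zero => assumption
  | succ n => exact inferInstanceAs (SFinite (push vol _ _))

lemma measurable_push_density {k : S → S → ℝ≥0∞} (hk : Measurable (Function.uncurry k))
    (π : Measure S) [SFinite π] : Measurable fun z => ∫⁻ x, k x z ∂π :=
  hk.lintegral_prod_left

lemma push_mono {k k' : S → S → ℝ≥0∞} {π π' : Measure S} (hk : ∀ x z, k x z ≤ k' x z)
    (hπ : π ≤ π') : push vol k π ≤ push vol k' π' :=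
  withDensity_mono (ae_of_all _ fun z => lintegral_mono' hπ fun x => hk x z)

lemma push_add_density {k k' : S → S → ℝ≥0∞} (hk : Measurable (Function.uncurry k))
    (π : Measure S) [SFinite π] :
    push vol (fun x z => k x z + k' x z) π = push vol k π + push vol k' π := by
  have h : (fun z => ∫⁻ x, (k x z + k' x z) ∂π)
      = (fun z => ∫⁻ x, k x z ∂π) + fun z => ∫⁻ x, k' x z ∂π := by
    funext z
    exact lintegral_add_left (hk.comp (measurable_id.prodMk measurable_const)) _
  rw [push, h, withDensity_add_left (measurable_push_density hk π)]
  rfl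

lemma push_smul_density {k : S → S → ℝ≥0∞} (hk : Measurable (Function.uncurry k))
    (c : ℝ≥0∞) (π : Measure S) [SFinite π] :
    push vol (fun x z => c * k x z) π = c • push vol k π := by
  have h : (fun z => ∫⁻ x, c * k x z ∂π) = c • fun z => ∫⁻ x, k x z ∂π := by
    funext z
    exact lintegral_const_mul c (hk.comp (measurable_id.prodMk measurable_const))
  rw [push, h, withDensity_smul c (measurable_push_density hk π)]
  rfl

lemma push_add_measure {k : S → S → ℝ≥0∞} (hk : Measurable (Function.uncurry k))
    (π π' : Measure S) [SFinite π] :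
    push vol k (π + π') = push vol k π + push vol k π' := by
  have h : (fun z => ∫⁻ x, k x z ∂(π + π'))
      = (fun z => ∫⁻ x, k x z ∂π) + fun z => ∫⁻ x, k x z ∂π' := by
    funext z
    exact lintegral_add_measure _ _ _
  rw [push, h, withDensity_add_left (measurable_push_density hk π)]
  rfl

lemma push_smul_measure {k : S → S → ℝ≥0∞} (hk : Measurable (Function.uncurry k))
    (c : ℝ≥0∞) (π : Measure S) [SFinite π] :
    push vol k (c • π) = c • push vol k π := by
  have h : (fun z => ∫⁻ x, k x z ∂(c • π)) = c • fun z => ∫⁻ x, k x z ∂π := by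
    funext z
    exact lintegral_smul_measure c _
  rw [push, h, withDensity_smul c (measurable_push_density hk π)]
  rfl

lemma lintegral_push [SFinite vol] {k : S → S → ℝ≥0∞} (hk : Measurable (Function.uncurry k))
    (π : Measure S) [SFinite π] {φ : S → ℝ≥0∞} (hφ : Measurable φ) :
    ∫⁻ z, φ z ∂(push vol k π) = ∫⁻ x, ∫⁻ z, k x z * φ z ∂vol ∂π := by
  rw [push, lintegral_withDensity_eq_lintegral_mul _ (measurable_push_density hk π) hφ,
    lintegral_lintegral_swap]
  · refine lintegral_congr fun z => ?_
    exact (lintegral_mul_const _ (hk.comp (measurable_id.prodMk measurable_const))).symm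
  · exact (hk.mul (hφ.comp measurable_snd)).aemeasurable

/-- If one step of the dynamics increases `φ n` at most by the factor `c`, then `n` steps increase
it at most by `c ^ n`. -/
lemma lintegral_pushSeq_le [SFinite vol] {k : ℕ → S → S → ℝ≥0∞}
    (hk : ∀ n, Measurable (Function.uncurry (k n))) (π : Measure S) [SFinite π]
    {φ : ℕ → S → ℝ≥0∞} (hφ : ∀ n, Measurable (φ n)) {c : ℝ≥0∞}
    (h : ∀ n x, ∫⁻ z, k n x z * φ (n + 1) z ∂vol ≤ c * φ n x) (n : ℕ) :
    ∫⁻ z, φ n z ∂(pushSeq vol k π n) ≤ c ^ n * ∫⁻ z, φ 0 z ∂π := by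
  induction n with
  | zero => simp [pushSeq]
  | succ n ih =>
    calc ∫⁻ z, φ (n + 1) z ∂(push vol (k n) (pushSeq vol k π n))
        = ∫⁻ x, ∫⁻ z, k n x z * φ (n + 1) z ∂vol ∂(pushSeq vol k π n) :=
          lintegral_push (hk n) _ (hφ _)
      _ ≤ ∫⁻ x, c * φ n x ∂(pushSeq vol k π n) := lintegral_mono fun x => h n x
      _ = c * ∫⁻ x, φ n x ∂(pushSeq vol k π n) := lintegral_const_mul c (hφ n)
      _ ≤ c * (c ^ n * ∫⁻ z, φ 0 z ∂π) := by gcongr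
      _ = c ^ (n + 1) * ∫⁻ z, φ 0 z ∂π := by ring

lemma pushSeq_mono {k k' : ℕ → S → S → ℝ≥0∞} (hk : ∀ n x z, k n x z ≤ k' n x z)
    (π : Measure S) (n : ℕ) : pushSeq vol k π n ≤ pushSeq vol k' π n := by
  induction n with
  | zero => exact le_rfl
  | succ n ih => exact push_mono (hk n) ih

/-- The two-way estimate behind the rate of forgetting. Let the dynamics `k = kg + kb` be split into
good and bad transitions, and let `r` be a dynamics which on good transitions is smaller than `k`
by the factor `ρ`, at the times listed by `u`. A trajectory with at most `j` bad transitions is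
reduced by the factor `ρ ^ (#u - j)` at least, where `#u` is the number of these times before `n`;
the mass of the other trajectories is at most `θ ^ j` times what it becomes when every bad
transition is given the weight `θ⁻¹`. -/
lemma pushSeq_le_good_add_bad {kg kb r : ℕ → S → S → ℝ≥0∞}
    [SFinite vol] (hkg : ∀ n, Measurable (Function.uncurry (kg n)))
    (hkb : ∀ n, Measurable (Function.uncurry (kb n)))
    {ρ θ : ℝ≥0∞} (hρ : ρ ≤ 1) (hθ0 : θ ≠ 0) (hθ : θ ≤ 1) (u : ℕ → Prop) [DecidablePred u]
    (hr : ∀ n x z, r n x z ≤ (if u n then ρ else 1) * kg n x z + kb n x z)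
    (π : Measure S) [SFinite π] (n j : ℕ) :
    pushSeq vol r π n ≤
      ρ ^ (Nat.count u n - j) • pushSeq vol (fun n x z => kg n x z + kb n x z) π n +
        θ ^ j • pushSeq vol (fun n x z => kg n x z + θ⁻¹ * kb n x z) π n := by
  set k : ℕ → S → S → ℝ≥0∞ := fun n x z => kg n x z + kb n x z with hk
  set w : ℕ → S → S → ℝ≥0∞ := fun n x z => kg n x z + θ⁻¹ * kb n x z with hw
  have hθi : 1 ≤ θ⁻¹ := ENNReal.one_le_inv.2 hθ
  have hθtop : θ ≠ ∞ := (hθ.trans_lt ENNReal.one_lt_top).ne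
  have hone : ∀ n, (if u n then ρ else 1) ≤ (1 : ℝ≥0∞) := fun n => by split_ifs <;> simp [hρ]
  induction n generalizing j with
  | zero =>
    simp only [pushSeq, Nat.count_zero, Nat.zero_sub, pow_zero, one_smul]
    exact Measure.le_add_right le_rfl
  | succ n ih =>
    cases j with
    | zero =>
      refine Measure.le_add_left ?_
      rw [pow_zero, one_smul]
      refine pushSeq_mono (fun m x z => (hr m x z).trans ?_) π _
      exact add_le_add (mul_le_of_le_one_left' (hone m)) (le_mul_of_one_le_left' hθi)
    | succ j =>
      have hsplit : pushSeq vol r π (n + 1) ≤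
          (if u n then ρ else 1) • push vol (kg n) (pushSeq vol r π n)
            + push vol (kb n) (pushSeq vol r π n) := by
        refine (push_mono (hr n) le_rfl).trans_eq ?_
        rw [push_add_density (k := fun x z => (if u n then ρ else 1) * kg n x z)
          ((hkg n).const_mul _), push_smul_density (hkg n)]
      have hbound : ∀ {q : S → S → ℝ≥0∞}, Measurable (Function.uncurry q) → ∀ i,
          push vol q (pushSeq vol r π n) ≤ ρ ^ (Nat.count u n - i) • push vol q (pushSeq vol k π n)
            + θ ^ i • push vol q (pushSeq vol w π n) := by
        intro q hq i
        refine (push_mono (fun _ _ => le_rfl) (ih i)).trans_eq ?_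
        rw [push_add_measure hq, push_smul_measure hq, push_smul_measure hq]
      have hk' : pushSeq vol k π (n + 1) =
          push vol (kg n) (pushSeq vol k π n) + push vol (kb n) (pushSeq vol k π n) :=
        push_add_density (hkg n) _
      have hw' : pushSeq vol w π (n + 1) =
          push vol (kg n) (pushSeq vol w π n) + θ⁻¹ • push vol (kb n) (pushSeq vol w π n) := by
        rw [← push_smul_density (hkb n)]
        exact push_add_density (hkg n) _
      rw [hk', hw']
      refine hsplit.trans (Measure.le_iff'.2 fun s => ?_)
      have h1 := Measure.le_iff'.1 (hbound (hkg n) (j + 1)) s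
      have h2 := Measure.le_iff'.1 (hbound (hkb n) j) s
      simp only [Measure.add_apply, Measure.smul_apply, smul_eq_mul] at h1 h2 ⊢
      set Ag := push vol (kg n) (pushSeq vol k π n) s
      set Ab := push vol (kb n) (pushSeq vol k π n) s
      set Bg := push vol (kg n) (pushSeq vol w π n) s
      set Bb := push vol (kb n) (pushSeq vol w π n) s
      have e1 : (if u n then ρ else 1) * ρ ^ (Nat.count u n - (j + 1)) ≤
          ρ ^ (Nat.count u (n + 1) - (j + 1)) := by
        rw [Nat.count_succ]
        split_ifs with hu
        · rw [← pow_succ']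
          exact pow_le_pow_right_of_le_one' hρ (by omega)
        · simp
      have e2 : ρ ^ (Nat.count u n - j) ≤ ρ ^ (Nat.count u (n + 1) - (j + 1)) := by
        rw [Nat.count_succ]
        refine pow_le_pow_right_of_le_one' hρ ?_
        split_ifs <;> omega
      have e3 : θ ^ (j + 1) * θ⁻¹ = θ ^ j := by
        rw [pow_succ, mul_assoc, ENNReal.mul_inv_cancel hθ0 hθtop, mul_one]
      calc _ ≤ (if u n then ρ else 1) *
              (ρ ^ (Nat.count u n - (j + 1)) * Ag + θ ^ (j + 1) * Bg) +
            (ρ ^ (Nat.count u n - j) * Ab + θ ^ j * Bb) := by gcongr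
        _ = ((if u n then ρ else 1) * ρ ^ (Nat.count u n - (j + 1))) * Ag +
            ρ ^ (Nat.count u n - j) * Ab +
            ((if u n then ρ else 1) * (θ ^ (j + 1) * Bg) + θ ^ j * Bb) := by ring
        _ ≤ ρ ^ (Nat.count u (n + 1) - (j + 1)) * Ag +
            ρ ^ (Nat.count u (n + 1) - (j + 1)) * Ab +
            (1 * (θ ^ (j + 1) * Bg) + θ ^ j * Bb) := by
          gcongr
          exact hone n
        _ = _ := by rw [← e3]; ring

end Push

/-! ### Symmetric minorants cancel -/

section Swap

variable {X : Type*} [MeasurableSpace X] {vol : Measure X}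

lemma map_swap_push [SFinite vol] {k : X × X → X × X → ℝ≥0∞} (hk : Measurable (Function.uncurry k))
    (π : Measure (X × X)) [SFinite π] :
    (push (vol.prod vol) k π).map Prod.swap =
      push (vol.prod vol) (fun x z => k x z.swap) π := by
  ext A hA
  rw [Measure.map_apply measurable_swap hA, push, push,
    withDensity_apply _ (measurable_swap hA), withDensity_apply _ hA]
  have := (Measure.measurePreserving_swap (μ := vol) (ν := vol)).setLIntegral_comp_preimage hA
    (f := fun z => ∫⁻ x, k x z.swap ∂π) ((measurable_push_density hk π).comp measurable_swap)
  simpa using this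

lemma push_map_swap {k : X × X → X × X → ℝ≥0∞} (hk : Measurable (Function.uncurry k))
    (π : Measure (X × X)) :
    push (vol.prod vol) k (π.map Prod.swap) =
      push (vol.prod vol) (fun x z => k x.swap z) π := by
  unfold push
  congr 1
  funext z
  exact lintegral_map (hk.comp (measurable_id.prodMk measurable_const)) measurable_swap

/-- Let `m ≤ k`, where `k` commutes with the exchange of the two coordinates and `m x` is invariant
under it for every `x`. Up to a symmetric measure, the dynamics `k` may be replaced
by `k - m`. -/
lemma exists_symmetric_add_pushSeq [SFinite vol] {k r m : ℕ → X × X → X × X → ℝ≥0∞}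
    (hr : ∀ n, Measurable (Function.uncurry (r n))) (hm : ∀ n, Measurable (Function.uncurry (m n)))
    (hk : ∀ n x z, k n x z = m n x z + r n x z)
    (hks : ∀ n x z, k n x.swap z.swap = k n x z) (hms : ∀ n x z, m n x z.swap = m n x z)
    (π : Measure (X × X)) [SFinite π] (n : ℕ) :
    ∃ s : Measure (X × X), SFinite s ∧ s.map Prod.swap = s ∧
      pushSeq (vol.prod vol) k π n = s + pushSeq (vol.prod vol) r π n := by
  have hkm : ∀ n, Measurable (Function.uncurry (k n)) := fun n => by
    have : Function.uncurry (k n) = Function.uncurry (m n) + Function.uncurry (r n) := by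
      funext p; exact hk n p.1 p.2
    rw [this]; exact (hm n).add (hr n)
  induction n with
  | zero => exact ⟨0, inferInstance, by simp, by simp [pushSeq]⟩
  | succ n ih =>
    obtain ⟨s, hs, hswap, heq⟩ := ih
    refine ⟨push (vol.prod vol) (k n) s +
      push (vol.prod vol) (m n) (pushSeq (vol.prod vol) r π n), inferInstance, ?_, ?_⟩
    · rw [Measure.map_add _ _ measurable_swap, map_swap_push (hkm n), map_swap_push (hm n)]
      simp only [hms]
      congr 1
      conv_rhs => rw [← hswap, push_map_swap (hkm n)]
      congr 1
      funext x z
      rw [← hks, Prod.swap_swap]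
    · have h1 : pushSeq (vol.prod vol) k π (n + 1) = push (vol.prod vol) (k n) s +
          push (vol.prod vol) (k n) (pushSeq (vol.prod vol) r π n) := by
        rw [← push_add_measure (hkm n), ← heq]; rfl
      have h2 : push (vol.prod vol) (k n) (pushSeq (vol.prod vol) r π n) =
          push (vol.prod vol) (m n) (pushSeq (vol.prod vol) r π n) +
            pushSeq (vol.prod vol) r π (n + 1) := by
        rw [show k n = fun x z => m n x z + r n x z from funext₂ (hk n),
          push_add_density (hm n)]
        rfl
      rw [h1, h2, add_assoc]

end Swap

/-! ### Pairs of filters -/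

section Pairs

variable {X Y : Type*} [MeasurableSpace X] {vol : Measure X}

/-- The density of one step of two unnormalised filters run in parallel: both coordinates move with
transition density `q` and are then weighted by the likelihood `G`. -/
noncomputable def pairDensity (q : X → X → ℝ≥0∞) (G : X → ℝ≥0∞) (x z : X × X) : ℝ≥0∞ :=
  q x.1 z.1 * q x.2 z.2 * (G z.1 * G z.2)

lemma measurable_pairDensity {q : X → X → ℝ≥0∞} (hq : Measurable (Function.uncurry q))
    {G : X → ℝ≥0∞} (hG : Measurable G) : Measurable (Function.uncurry (pairDensity q G)) := by
  have h1 : Measurable fun p : (X × X) × (X × X) => q p.1.1 p.2.1 :=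
    hq.comp (f := fun p : (X × X) × (X × X) => (p.1.1, p.2.1)) (by fun_prop)
  have h2 : Measurable fun p : (X × X) × (X × X) => q p.1.2 p.2.2 :=
    hq.comp (f := fun p : (X × X) × (X × X) => (p.1.2, p.2.2)) (by fun_prop)
  exact (h1.mul h2).mul ((hG.comp (by fun_prop)).mul (hG.comp (by fun_prop)))

lemma push_prod [SFinite vol] {k : X → X → ℝ≥0∞} (hk : Measurable (Function.uncurry k))
    (μ μ' : Measure X) [SFinite μ] [SFinite μ'] :
    (push vol k μ).prod (push vol k μ') =
      push (vol.prod vol) (fun x z => k x.1 z.1 * k x.2 z.2) (μ.prod μ') := by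
  unfold push
  rw [prod_withDensity (measurable_push_density hk μ) (measurable_push_density hk μ')]
  congr 1
  funext z
  exact (lintegral_prod_mul (hk.comp (measurable_id.prodMk measurable_const)).aemeasurable
    (hk.comp (measurable_id.prodMk measurable_const)).aemeasurable).symm

variable {Q : Kernel X X} {q : X → X → ℝ≥0∞} {g : X → Y → ℝ≥0∞} {y : ℕ → Y}

instance (ν : Measure X) [SFinite ν] [IsSFiniteKernel Q] (n : ℕ) :
    SFinite (unnormFilter Q g ν y n) := by
  cases n with
  | zero => unfold unnormFilter; infer_instance
  | succ n =>
    have : SFinite (unnormFilter Q g ν y n) := by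
      induction n with
      | zero => unfold unnormFilter; infer_instance
      | succ n ih => unfold unnormFilter; infer_instance
    unfold unnormFilter; infer_instance

lemma unnormFilter_succ [SFinite vol] [IsSFiniteKernel Q] (hq : Measurable (Function.uncurry q))
    (hQ : ∀ x, Q x = vol.withDensity (q x)) (hg : ∀ n, Measurable fun x => g x (y n))
    (ν : Measure X) [SFinite ν] (n : ℕ) :
    unnormFilter Q g ν y (n + 1) =
      push vol (fun x z => q x z * g z (y (n + 1))) (unnormFilter Q g ν y n) := by
  set μ := unnormFilter Q g ν y n with hμ
  have hbind : μ.bind Q = push vol q μ := by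
    ext A hA
    rw [Measure.bind_apply hA Q.aemeasurable, push, withDensity_apply _ hA,
      ← lintegral_lintegral_swap hq.aemeasurable]
    exact lintegral_congr fun x => by rw [hQ, withDensity_apply _ hA]
  have : unnormFilter Q g ν y (n + 1) =
      (μ.bind Q).withDensity (fun x => g x (y (n + 1))) := rfl
  rw [this, hbind, push, push, ← withDensity_mul _ (measurable_push_density hq μ) (hg _)]
  congr 1
  funext z
  exact (lintegral_mul_const _ (hq.comp (measurable_id.prodMk measurable_const))).symm

lemma unnormFilter_prod [SFinite vol] [IsSFiniteKernel Q] (hq : Measurable (Function.uncurry q))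
    (hQ : ∀ x, Q x = vol.withDensity (q x)) (hg : ∀ n, Measurable fun x => g x (y n))
    (ν ν' : Measure X) [SFinite ν] [SFinite ν'] (n : ℕ) :
    (unnormFilter Q g ν y n).prod (unnormFilter Q g ν' y n) =
      pushSeq (vol.prod vol) (fun n => pairDensity q fun z => g z (y (n + 1)))
        ((unnormFilter Q g ν y 0).prod (unnormFilter Q g ν' y 0)) n := by
  induction n with
  | zero => rfl
  | succ n ih =>
    rw [unnormFilter_succ hq hQ hg, unnormFilter_succ hq hQ hg,
      push_prod (hq.mul ((hg _).comp measurable_snd)), ih, pushSeq]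
    congr 1
    funext x z
    simp only [pairDensity]
    ring

lemma unnormFilter_univ_le [IsMarkovKernel Q] {V : ℝ≥0∞}
    (hV : ∀ n x, g x (y n) ≤ V)
    (ν : Measure X) [IsProbabilityMeasure ν] (n : ℕ) :
    unnormFilter Q g ν y n Set.univ ≤ V ^ (n + 1) := by
  have key : ∀ (μ : Measure X) (n : ℕ),
      μ.withDensity (fun x => g x (y n)) Set.univ ≤ V * μ Set.univ := fun μ n => by
    rw [withDensity_apply _ .univ, Measure.restrict_univ]
    exact (lintegral_mono fun x => hV n x).trans_eq (by simp)
  induction n with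
  | zero => exact (key ν 0).trans_eq (by simp)
  | succ n ih =>
    refine (key _ (n + 1)).trans ?_
    rw [Measure.bind_apply .univ Q.aemeasurable]
    simp only [measure_univ, lintegral_one]
    calc V * unnormFilter Q g ν y n Set.univ ≤ V * V ^ (n + 1) := by gcongr
      _ = V ^ (n + 1 + 1) := by ring

/-- If `μ ⊗ μ'` is a symmetric measure plus `r`, the normalised measures are at distance at
most the mass of `r`, divided by that of `μ ⊗ μ'`. -/
lemma tvDist_normalize_le {μ μ' : Measure X} [SFinite μ] [SFinite μ'] {s r : Measure (X × X)}
    (hs : s.map Prod.swap = s) (h : μ.prod μ' = s + r)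
    (h0 : μ Set.univ ≠ 0) (ht : μ Set.univ ≠ ∞) (h0' : μ' Set.univ ≠ 0) (ht' : μ' Set.univ ≠ ∞) :
    tvDist ((μ Set.univ)⁻¹ • μ) ((μ' Set.univ)⁻¹ • μ') ≤
      r Set.univ / (μ Set.univ * μ' Set.univ) := by
  have hsw : ∀ A : Set X, MeasurableSet A → s (A ×ˢ Set.univ) = s (Set.univ ×ˢ A) := fun A hA => by
    conv_lhs => rw [← hs, Measure.map_apply measurable_swap (hA.prod .univ)]
    congr 1
    ext; simp
  set a := μ Set.univ
  set a' := μ' Set.univ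
  set d := r Set.univ / (a * a') with hd
  have e1 : ∀ A : Set X, MeasurableSet A → μ A * a' = s (A ×ˢ Set.univ) + r (A ×ˢ Set.univ) :=
    fun A _ => by rw [← Measure.add_apply, ← h, Measure.prod_prod]
  have e2 : ∀ A : Set X, MeasurableSet A → a * μ' A = s (A ×ˢ Set.univ) + r (Set.univ ×ˢ A) :=
    fun A hA => by rw [hsw A hA, ← Measure.add_apply, ← h, Measure.prod_prod]
  have hle : ∀ A : Set X, MeasurableSet A → μ A * a' ≤ a * μ' A + r Set.univ ∧
      a * μ' A ≤ μ A * a' + r Set.univ := fun A hA => by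
    rw [e1 A hA, e2 A hA]
    constructor
    · rw [add_assoc]
      gcongr
      exact le_add_left (measure_mono (Set.subset_univ _))
    · rw [add_assoc]
      gcongr
      exact le_add_left (measure_mono (Set.subset_univ _))
  have hinv : a⁻¹ * a = 1 := ENNReal.inv_mul_cancel h0 ht
  have hinv' : a'⁻¹ * a' = 1 := ENNReal.inv_mul_cancel h0' ht'
  have hd' : d = a⁻¹ * a'⁻¹ * r Set.univ := by
    rw [hd, ENNReal.div_eq_inv_mul, ENNReal.mul_inv (.inl h0) (.inl ht)]
  have f1 : ∀ A, a⁻¹ * μ A = a⁻¹ * a'⁻¹ * (μ A * a') := fun A => by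
    calc a⁻¹ * μ A = a⁻¹ * μ A * (a'⁻¹ * a') := by rw [hinv', mul_one]
      _ = _ := by ring
  have f2 : ∀ A, a'⁻¹ * μ' A = a⁻¹ * a'⁻¹ * (a * μ' A) := fun A => by
    calc a'⁻¹ * μ' A = a'⁻¹ * μ' A * (a⁻¹ * a) := by rw [hinv, mul_one]
      _ = _ := by ring
  refine iSup₂_le fun A hA => ?_
  obtain ⟨l1, l2⟩ := hle A hA
  have g1 : a⁻¹ * μ A ≤ a'⁻¹ * μ' A + d := by
    rw [f1, f2, hd', ← mul_add]; gcongr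
  have g2 : a'⁻¹ * μ' A ≤ a⁻¹ * μ A + d := by
    rw [f1, f2, hd', ← mul_add]; gcongr
  have t1 : a⁻¹ * μ A ≠ ∞ :=
    ENNReal.mul_ne_top (ENNReal.inv_ne_top.2 h0) (measure_ne_top_of_subset (Set.subset_univ A) ht)
  have t2 : a'⁻¹ * μ' A ≠ ∞ :=
    ENNReal.mul_ne_top (ENNReal.inv_ne_top.2 h0') (measure_ne_top_of_subset (Set.subset_univ A) ht')
  by_cases hdt : d = ∞
  · rw [hdt]; exact le_top
  rw [ENNReal.ofReal_le_iff_le_toReal hdt]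
  simp only [Measure.real, Measure.smul_apply, smul_eq_mul]
  have m1 := ENNReal.toReal_mono (ENNReal.add_ne_top.2 ⟨t2, hdt⟩) g1
  have m2 := ENNReal.toReal_mono (ENNReal.add_ne_top.2 ⟨t1, hdt⟩) g2
  rw [ENNReal.toReal_add t2 hdt] at m1
  rw [ENNReal.toReal_add t1 hdt] at m2
  rw [abs_le]
  constructor <;> linarith

end Pairs

/-! ### Forgetting along a fixed sequence of observations -/

section Deterministic

variable {X Y : Type*} [MeasurableSpace X] {vol : Measure X} [SFinite vol]
  {q : X → X → ℝ≥0∞} {G : ℕ → X → ℝ≥0∞} {C : ℕ → Set X}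

/-- The transitions of a pair of states at time `n` that are called good: the pair moves from
`C n × C n` to `C (n + 1) × C (n + 1)`, and its transition density is at most `M ^ 2`. -/
def goodSet (q : X → X → ℝ≥0∞) (C : ℕ → Set X) (M : ℝ≥0∞) (n : ℕ) : Set ((X × X) × (X × X)) :=
  {p | p.1 ∈ C n ×ˢ C n ∧ p.2 ∈ C (n + 1) ×ˢ C (n + 1) ∧ q p.1.1 p.2.1 * q p.1.2 p.2.2 ≤ M ^ 2}

open Classical in
/-- The weight `1` on `C n × C n` and `θ⁻¹` off it. -/
noncomputable def penalty (C : ℕ → Set X) (θ : ℝ≥0∞) (n : ℕ) (x : X × X) : ℝ≥0∞ :=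
  if x ∈ C n ×ˢ C n then 1 else θ⁻¹

lemma measurableSet_goodSet (hq : Measurable (Function.uncurry q)) (hC : ∀ n, MeasurableSet (C n))
    (M : ℝ≥0∞) (n : ℕ) : MeasurableSet (goodSet q C M n) := by
  have h1 : Measurable fun p : (X × X) × (X × X) => q p.1.1 p.2.1 :=
    hq.comp (f := fun p : (X × X) × (X × X) => (p.1.1, p.2.1)) (by fun_prop)
  have h2 : Measurable fun p : (X × X) × (X × X) => q p.1.2 p.2.2 :=
    hq.comp (f := fun p : (X × X) × (X × X) => (p.1.2, p.2.2)) (by fun_prop)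
  exact (measurable_fst ((hC n).prod (hC n))).inter
    ((measurable_snd ((hC (n + 1)).prod (hC (n + 1)))).inter
      (measurableSet_le (h1.mul h2) measurable_const))

lemma measurable_penalty (hC : ∀ n, MeasurableSet (C n)) (θ : ℝ≥0∞) (n : ℕ) :
    Measurable (penalty C θ n) :=
  Measurable.ite ((hC n).prod (hC n)) measurable_const measurable_const

/-- One step of the dynamics in which bad transitions are given the weight `θ⁻¹` multiplies the
penalty by a factor that does not depend on `θ`: a bad transition starts off `C n`, ends off
`C (n + 1)`, where the likelihood is at most `θ ^ 2`, or has a large density, an event of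
probability at most `θ` in each coordinate. -/
lemma lintegral_weighted_mul_penalty_le (hq : Measurable (Function.uncurry q))
    (hq1 : ∀ x, ∫⁻ z, q x z ∂vol = 1) {V : ℝ≥0∞} (hV1 : 1 ≤ V)
    (hV : ∀ n x, G n x ≤ V) {θ M : ℝ≥0∞} (hθ0 : θ ≠ 0) (hθ : θ ≤ 1)
    (hout : ∀ n, ∀ z ∉ C n, G n z ≤ θ ^ 2)
    (htail : ∀ x, ∫⁻ z, {z | M < q x z}.indicator (q x) z ∂vol ≤ θ) (n : ℕ) (x : X × X) :
    ∫⁻ z, ((goodSet q C M n).indicator (Function.uncurry (pairDensity q (G (n + 1)))) (x, z) +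
        θ⁻¹ * (goodSet q C M n)ᶜ.indicator (Function.uncurry (pairDensity q (G (n + 1)))) (x, z)) *
        penalty C θ (n + 1) z ∂(vol.prod vol) ≤ 4 * V ^ 2 * penalty C θ n x := by
  have hθi : 1 ≤ θ⁻¹ := ENNReal.one_le_inv.2 hθ
  have hθtop : θ ≠ ∞ := (hθ.trans_lt ENNReal.one_lt_top).ne
  have hθc : θ⁻¹ * θ = 1 := ENNReal.inv_mul_cancel hθ0 hθtop
  have hqx : ∀ x, Measurable (q x) := fun x => hq.comp (measurable_const.prodMk measurable_id)
  set J : X → X → ℝ≥0∞ := fun x => {z | M < q x z}.indicator (q x) with hJ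
  have hJm : ∀ x, Measurable (J x) := fun x =>
    (hqx x).indicator (measurableSet_lt measurable_const (hqx x))
  have hpen : 1 ≤ penalty C θ n x := by
    unfold penalty; split_ifs <;> simp [hθ]
  have hVV : ∀ z : X × X, G (n + 1) z.1 * G (n + 1) z.2 ≤ V ^ 2 := fun z => by
    rw [sq]; exact mul_le_mul' (hV _ _) (hV _ _)
  -- The term `V` accounts for transitions that end off `C (n + 1)`, the last two summands for a
  -- large density, and `V ^ 2` for all others; a start off `C n` is paid for by the penalty at `x`.
  have hpt : ∀ z : X × X,
      ((goodSet q C M n).indicator (Function.uncurry (pairDensity q (G (n + 1)))) (x, z) +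
        θ⁻¹ * (goodSet q C M n)ᶜ.indicator (Function.uncurry (pairDensity q (G (n + 1)))) (x, z)) *
        penalty C θ (n + 1) z ≤ penalty C θ n x * ((V ^ 2 + V) * (q x.1 z.1 * q x.2 z.2) +
          θ⁻¹ * V ^ 2 * (J x.1 z.1 * q x.2 z.2) + θ⁻¹ * V ^ 2 * (q x.1 z.1 * J x.2 z.2)) := by
    intro z
    set A := q x.1 z.1 * q x.2 z.2 with hA
    set GG := G (n + 1) z.1 * G (n + 1) z.2 with hGG
    have hkA : Function.uncurry (pairDensity q (G (n + 1))) (x, z) = A * GG := rfl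
    have hwle : ∀ p, (goodSet q C M n).indicator
          (Function.uncurry (pairDensity q (G (n + 1)))) p +
        θ⁻¹ * (goodSet q C M n)ᶜ.indicator
          (Function.uncurry (pairDensity q (G (n + 1)))) p ≤
          θ⁻¹ * Function.uncurry (pairDensity q (G (n + 1))) p := by
      intro p
      by_cases hp : p ∈ goodSet q C M n
      · simpa [hp] using le_mul_of_one_le_left' hθi
      · simp [hp]
    by_cases hz : z ∈ C (n + 1) ×ˢ C (n + 1)
    · have hp1 : penalty C θ (n + 1) z = 1 := by simp [penalty, hz]
      rw [hp1, mul_one]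
      by_cases hx : x ∈ C n ×ˢ C n
      · have hp0 : penalty C θ n x = 1 := by simp [penalty, hx]
        rw [hp0, one_mul]
        by_cases hM : A ≤ M ^ 2
        · have hgood : (x, z) ∈ goodSet q C M n := ⟨hx, hz, hM⟩
          rw [Set.indicator_of_mem hgood, Set.indicator_of_notMem
            (fun h : (x, z) ∈ (goodSet q C M n)ᶜ => h hgood), mul_zero, add_zero, hkA]
          calc A * GG ≤ A * V ^ 2 := by gcongr; exact hVV z
            _ ≤ (V ^ 2 + V) * A := by rw [mul_comm]; gcongr; exact le_self_add
            _ ≤ _ := by rw [add_assoc]; exact le_self_add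
        · have hor : A ≤ J x.1 z.1 * q x.2 z.2 + q x.1 z.1 * J x.2 z.2 := by
            by_cases h1 : M < q x.1 z.1
            · have : J x.1 z.1 = q x.1 z.1 := Set.indicator_of_mem (s := {z | M < q x.1 z}) h1 _
              rw [this]; exact le_self_add
            · have h2 : M < q x.2 z.2 := by
                by_contra h2
                refine hM ?_
                rw [sq]
                exact mul_le_mul' (not_lt.1 h1) (not_lt.1 h2)
              have : J x.2 z.2 = q x.2 z.2 := Set.indicator_of_mem (s := {z | M < q x.2 z}) h2 _
              rw [this]; exact le_add_self
          refine (hwle _).trans ?_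
          rw [hkA, add_assoc, ← mul_add]
          refine le_add_left ?_
          calc θ⁻¹ * (A * GG)
              ≤ θ⁻¹ * ((J x.1 z.1 * q x.2 z.2 + q x.1 z.1 * J x.2 z.2) * V ^ 2) := by
                gcongr; exact hVV z
            _ = _ := by ring
      · have hp0 : penalty C θ n x = θ⁻¹ := by simp [penalty, hx]
        rw [hp0]
        refine (hwle _).trans ?_
        rw [hkA]
        gcongr
        calc A * GG ≤ A * V ^ 2 := by gcongr; exact hVV z
            _ ≤ (V ^ 2 + V) * A := by rw [mul_comm]; gcongr; exact le_self_add
            _ ≤ _ := by rw [add_assoc]; exact le_self_add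
    · have hp1 : penalty C θ (n + 1) z = θ⁻¹ := by simp [penalty, hz]
      have hGG2 : GG ≤ θ ^ 2 * V := by
        by_cases h1 : z.1 ∈ C (n + 1)
        · have h2 : z.2 ∉ C (n + 1) := fun h2 => hz ⟨h1, h2⟩
          rw [mul_comm (θ ^ 2)]
          exact mul_le_mul' (hV _ _) (hout _ _ h2)
        · exact mul_le_mul' (hout _ _ h1) (hV _ _)
      calc _ ≤ θ⁻¹ * (A * GG) * θ⁻¹ := by rw [hp1]; gcongr; exact hwle _
        _ ≤ θ⁻¹ * (A * (θ ^ 2 * V)) * θ⁻¹ := by gcongr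
        _ = (θ⁻¹ * θ) * (θ⁻¹ * θ) * (V * A) := by ring
        _ = 1 * (V * A) := by rw [hθc]; ring
        _ ≤ penalty C θ n x * ((V ^ 2 + V) * A) := by
          gcongr
          exact le_add_self
        _ ≤ _ := by gcongr; rw [add_assoc]; exact le_self_add
  have hAm : Measurable fun z : X × X => q x.1 z.1 * q x.2 z.2 :=
    ((hqx _).comp measurable_fst).mul ((hqx _).comp measurable_snd)
  have hJ1m : Measurable fun z : X × X => J x.1 z.1 * q x.2 z.2 :=
    ((hJm _).comp measurable_fst).mul ((hqx _).comp measurable_snd)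
  have hJ2m : Measurable fun z : X × X => q x.1 z.1 * J x.2 z.2 :=
    ((hqx _).comp measurable_fst).mul ((hJm _).comp measurable_snd)
  refine (lintegral_mono hpt).trans ?_
  rw [lintegral_const_mul _ (by fun_prop), lintegral_add_left (by fun_prop),
    lintegral_add_left (by fun_prop), lintegral_const_mul _ hAm, lintegral_const_mul _ hJ1m,
    lintegral_const_mul _ hJ2m, lintegral_prod_mul (hqx _).aemeasurable (hqx _).aemeasurable,
    lintegral_prod_mul (hJm _).aemeasurable (hqx _).aemeasurable,
    lintegral_prod_mul (hqx _).aemeasurable (hJm _).aemeasurable, hq1, hq1, one_mul, one_mul,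
    mul_one, mul_one, mul_comm]
  gcongr
  calc V ^ 2 + V + θ⁻¹ * V ^ 2 * ∫⁻ z, J x.1 z ∂vol + θ⁻¹ * V ^ 2 * ∫⁻ z, J x.2 z ∂vol
      ≤ V ^ 2 + V ^ 2 + θ⁻¹ * V ^ 2 * θ + θ⁻¹ * V ^ 2 * θ := by
        gcongr
        · exact le_self_pow hV1 two_ne_zero
        · exact htail _
        · exact htail _
    _ = 2 * V ^ 2 + 2 * V ^ 2 * (θ⁻¹ * θ) := by ring
    _ = 4 * V ^ 2 := by rw [hθc]; ring

variable {Q : Kernel X X} [IsMarkovKernel Q] {g : X → Y → ℝ≥0∞} {y : ℕ → Y}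

/-- Forgetting in finite time. The transition density `q` is at least `e` from `C n` to `C (n + 1)`
at the helpful times `n`, those with `u n`; the minorant that couples the two filters is
`e ^ 2` times the likelihood on these sets. The number `j` of bad transitions that is
tolerated is free. -/
theorem tvDist_filterDist_le (hq : Measurable (Function.uncurry q))
    (hQ : ∀ x, Q x = vol.withDensity (q x)) (hg : ∀ n, Measurable fun x => g x (y n))
    (hC : ∀ n, MeasurableSet (C n)) {V : ℝ≥0∞} (hV1 : 1 ≤ V) (hVt : V ≠ ∞)
    (hV : ∀ n x, g x (y n) ≤ V) {θ M e ρ : ℝ≥0∞} (hθ0 : θ ≠ 0) (hθ : θ ≤ 1)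
    (hM : M ≠ ∞) (hM0 : M ≠ 0) (hρ : ρ + (e / M) ^ 2 = 1)
    (hout : ∀ n, ∀ z ∉ C n, g z (y n) ≤ θ ^ 2)
    (htail : ∀ x, ∫⁻ z, {z | M < q x z}.indicator (q x) z ∂vol ≤ θ)
    (u : ℕ → Prop) [DecidablePred u]
    (hu : ∀ n, u n → ∀ x ∈ C n, ∀ z ∈ C (n + 1), e ≤ q x z)
    (ν ν' : Measure X) [IsProbabilityMeasure ν] [IsProbabilityMeasure ν'] (n j : ℕ)
    (h0 : unnormFilter Q g ν y n Set.univ ≠ 0) (h0' : unnormFilter Q g ν' y n Set.univ ≠ 0) :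
    tvDist (filterDist Q g ν y n) (filterDist Q g ν' y n) ≤
      ρ ^ (Nat.count u n - j) + θ ^ j * ((4 * V ^ 2) ^ n * (θ⁻¹ * V ^ 2)) /
        (unnormFilter Q g ν y n Set.univ * unnormFilter Q g ν' y n Set.univ) := by
  classical
  set μ := unnormFilter Q g ν y
  set μ' := unnormFilter Q g ν' y
  have hfin : μ n Set.univ ≠ ∞ :=
    ((unnormFilter_univ_le hV ν n).trans_lt (ENNReal.pow_lt_top hVt.lt_top)).ne
  have hfin' : μ' n Set.univ ≠ ∞ :=
    ((unnormFilter_univ_le hV ν' n).trans_lt (ENNReal.pow_lt_top hVt.lt_top)).ne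
  have hρ1 : ρ ≤ 1 := hρ ▸ le_self_add
  have hq1 : ∀ x, ∫⁻ z, q x z ∂vol = 1 := fun x => by
    have := measure_univ (μ := Q x)
    rwa [hQ, withDensity_apply _ .univ, Measure.restrict_univ] at this
  set k : ℕ → X × X → X × X → ℝ≥0∞ := fun n => pairDensity q fun z => g z (y (n + 1)) with hk
  set kg : ℕ → X × X → X × X → ℝ≥0∞ := fun n x z =>
    (goodSet q C M n).indicator (Function.uncurry (k n)) (x, z) with hkg
  set kb : ℕ → X × X → X × X → ℝ≥0∞ := fun n x z =>
    (goodSet q C M n)ᶜ.indicator (Function.uncurry (k n)) (x, z) with hkb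
  set m : ℕ → X × X → X × X → ℝ≥0∞ := fun n x z =>
    ((C n ×ˢ C n) ×ˢ (C (n + 1) ×ˢ C (n + 1))).indicator (fun p : (X × X) × (X × X) =>
      (if u n then e ^ 2 else 0) * (g p.2.1 (y (n + 1)) * g p.2.2 (y (n + 1)))) (x, z) with hm
  have hkm : ∀ n, Measurable (Function.uncurry (k n)) := fun n =>
    measurable_pairDensity hq (hg (n + 1))
  have hgm := measurableSet_goodSet hq hC M
  have hkgm : ∀ n, Measurable (Function.uncurry (kg n)) := fun n => (hkm n).indicator (hgm n)
  have hkbm : ∀ n, Measurable (Function.uncurry (kb n)) := fun n =>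
    (hkm n).indicator (hgm n).compl
  have hmm : ∀ n, Measurable (Function.uncurry (m n)) := fun n => by
    refine Measurable.indicator ?_
      (((hC n).prod (hC n)).prod ((hC (n + 1)).prod (hC (n + 1))))
    exact (((hg (n + 1)).comp (by fun_prop)).mul ((hg (n + 1)).comp (by fun_prop))).const_mul _
  have hkadd : ∀ n x z, k n x z = kg n x z + kb n x z := fun n x z =>
    (congrFun (Set.indicator_self_add_compl (goodSet q C M n) (Function.uncurry (k n)))
      (x, z)).symm
  have hmk : ∀ n x z, m n x z ≤ k n x z := fun n x z => by
    refine Set.indicator_le (fun p hp => ?_) (x, z) (g := Function.uncurry (k n))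
    obtain ⟨⟨hx1, hx2⟩, hz1, hz2⟩ := hp
    change _ ≤ q p.1.1 p.2.1 * q p.1.2 p.2.2 * (g p.2.1 (y (n + 1)) * g p.2.2 (y (n + 1)))
    gcongr
    split_ifs with hun
    · rw [sq]; exact mul_le_mul' (hu n hun _ hx1 _ hz1) (hu n hun _ hx2 _ hz2)
    · exact zero_le
  set r : ℕ → X × X → X × X → ℝ≥0∞ := fun n x z => k n x z - m n x z with hr
  have hrm : ∀ n, Measurable (Function.uncurry (r n)) := fun n => (hkm n).sub (hmm n)
  have hrle : ∀ n x z, r n x z ≤ (if u n then ρ else 1) * kg n x z + kb n x z := by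
    intro n x z
    rw [hr]
    simp only [tsub_le_iff_right]
    rw [hkadd]
    by_cases hun : u n
    · by_cases hgood : (x, z) ∈ goodSet q C M n
      · have hb : kb n x z = 0 := Set.indicator_of_notMem (not_not.2 hgood) _
        have hgd : kg n x z = q x.1 z.1 * q x.2 z.2 * (g z.1 (y (n + 1)) * g z.2 (y (n + 1))) :=
          Set.indicator_of_mem hgood _
        have hmv : m n x z = e ^ 2 * (g z.1 (y (n + 1)) * g z.2 (y (n + 1))) := by
          rw [hm]
          simp only [Set.indicator_of_mem (show (x, z) ∈ (C n ×ˢ C n) ×ˢ (C (n + 1) ×ˢ C (n + 1))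
            from ⟨hgood.1, hgood.2.1⟩), if_pos hun]
        rw [hb, hmv, if_pos hun, add_zero, add_zero]
        calc kg n x z = (ρ + (e / M) ^ 2) * kg n x z := by rw [hρ, one_mul]
          _ = ρ * kg n x z + (e / M) ^ 2 * (q x.1 z.1 * q x.2 z.2) *
              (g z.1 (y (n + 1)) * g z.2 (y (n + 1))) := by rw [hgd]; ring
          _ ≤ ρ * kg n x z + (e / M) ^ 2 * M ^ 2 *
              (g z.1 (y (n + 1)) * g z.2 (y (n + 1))) := by gcongr; exact hgood.2.2
          _ = _ := by rw [← mul_pow, ENNReal.div_mul_cancel hM0 hM]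
      · have hgd : kg n x z = 0 := Set.indicator_of_notMem hgood _
        rw [hgd, mul_zero, zero_add]
        exact le_self_add
    · rw [if_neg hun, one_mul]
      exact le_self_add
  obtain ⟨s, -, hs, hsum⟩ := exists_symmetric_add_pushSeq (vol := vol) (k := k) hrm hmm
    (fun n x z => (add_tsub_cancel_of_le (hmk n x z)).symm)
    (fun n x z => by simp only [hk, pairDensity, Prod.fst_swap, Prod.snd_swap]; ring)
    (fun n x z => by
      simp only [hm, Set.indicator, Set.mem_prod, Prod.fst_swap, Prod.snd_swap]
      congr 1
      · exact propext (by tauto)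
      · ring) ((μ 0).prod (μ' 0)) n
  rw [← unnormFilter_prod hq hQ hg] at hsum
  refine (tvDist_normalize_le hs hsum h0 hfin h0' hfin').trans ?_
  have hB := pushSeq_le_good_add_bad (vol := vol.prod vol) hkgm hkbm hρ1 hθ0 hθ u hrle
    ((μ 0).prod (μ' 0)) n j
  have hkeq : (fun n x z => kg n x z + kb n x z) = k := by
    funext n x z; exact (hkadd n x z).symm
  rw [hkeq, ← unnormFilter_prod hq hQ hg] at hB
  have hB1 := Measure.le_iff'.1 hB Set.univ
  simp only [Measure.add_apply, Measure.smul_apply, smul_eq_mul] at hB1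
  rw [← Set.univ_prod_univ (α := X) (β := X), Measure.prod_prod, Set.univ_prod_univ] at hB1
  set D := μ n Set.univ * μ' n Set.univ with hD
  have hD0 : D ≠ 0 := mul_ne_zero h0 h0'
  have hDt : D ≠ ∞ := ENNReal.mul_ne_top hfin hfin'
  have hτ : pushSeq (vol.prod vol) (fun n x z => kg n x z + θ⁻¹ * kb n x z)
      ((μ 0).prod (μ' 0)) n Set.univ ≤ (4 * V ^ 2) ^ n * (θ⁻¹ * V ^ 2) := by
    have hpen : ∀ n x, 1 ≤ penalty C θ n x := fun n x => by
      unfold penalty; split_ifs <;> simp [hθ]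
    have hpen' : ∀ n x, penalty C θ n x ≤ θ⁻¹ := fun n x => by
      unfold penalty; split_ifs <;> simp [hθ]
    have h1 := lintegral_pushSeq_le (vol := vol.prod vol)
      (k := fun n x z => kg n x z + θ⁻¹ * kb n x z)
      (fun n => (hkgm n).add ((hkbm n).const_mul _)) ((μ 0).prod (μ' 0))
      (measurable_penalty hC θ)
      (lintegral_weighted_mul_penalty_le (G := fun n x => g x (y n)) hq hq1 hV1 hV hθ0 hθ hout
        htail) n
    calc _ = ∫⁻ _, 1 ∂(pushSeq (vol.prod vol) (fun n x z => kg n x z + θ⁻¹ * kb n x z)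
          ((μ 0).prod (μ' 0)) n) := by simp
      _ ≤ _ := lintegral_mono fun x => hpen n x
      _ ≤ _ := h1
      _ ≤ (4 * V ^ 2) ^ n * (θ⁻¹ * V ^ 2) := by
        gcongr
        refine (lintegral_mono fun x => hpen' 0 x).trans ?_
        rw [lintegral_const, ← Set.univ_prod_univ, Measure.prod_prod, sq]
        gcongr
        · simpa using unnormFilter_univ_le hV ν 0
        · simpa using unnormFilter_univ_le hV ν' 0
  calc _ ≤ (ρ ^ (Nat.count u n - j) * D + θ ^ j * ((4 * V ^ 2) ^ n * (θ⁻¹ * V ^ 2))) / D := by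
        refine ENNReal.div_le_div_right (hB1.trans ?_) _
        gcongr
    _ = _ := by
      rw [ENNReal.add_div, mul_div_assoc, ENNReal.div_self hD0 hDt, mul_one]

end Deterministic

section LowerBound

variable {X Y : Type*} [MeasurableSpace X] {vol : Measure X} [SFinite vol]
  {q : X → X → ℝ≥0∞} {C : ℕ → Set X} {Q : Kernel X X} [IsSFiniteKernel Q]
  {g : X → Y → ℝ≥0∞} {y : ℕ → Y}

/-- The mass of the unnormalised filter is bounded below by the contribution of the trajectories
that stay in the sets `C 1, C 2, …`. -/
lemma prod_le_unnormFilter (hq : Measurable (Function.uncurry q))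
    (hQ : ∀ x, Q x = vol.withDensity (q x)) (hg : ∀ n, Measurable fun x => g x (y n))
    (hC : ∀ n, MeasurableSet (C n)) {e : ℕ → ℝ≥0∞} {κ : ℝ≥0∞}
    (he : ∀ n, ∀ x ∈ C n, ∀ z ∈ C (n + 1), e n ≤ q x z)
    (hκ : ∀ n, κ ≤ ∫⁻ z in C n, g z (y n) ∂vol) (ν : Measure X) [SFinite ν] (n : ℕ) :
    unnormFilter Q g ν y 1 (C 1) * ∏ i ∈ Finset.range n, (κ * e (i + 1)) ≤
      unnormFilter Q g ν y (n + 1) (C (n + 1)) := by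
  induction n with
  | zero => simp
  | succ n ih =>
    rw [Finset.prod_range_succ, ← mul_assoc]
    set μ := unnormFilter Q g ν y (n + 1) with hμ
    calc _ ≤ μ (C (n + 1)) * (κ * e (n + 1)) := by gcongr
      _ ≤ μ (C (n + 1)) * ((∫⁻ z in C (n + 1 + 1), g z (y (n + 1 + 1)) ∂vol) * e (n + 1)) := by
        gcongr; exact hκ _
      _ = ∫⁻ z in C (n + 1 + 1),
          ∫⁻ _ in C (n + 1), e (n + 1) * g z (y (n + 1 + 1)) ∂μ ∂vol := by
        simp only [lintegral_const, Measure.restrict_apply, MeasurableSet.univ, Set.univ_inter]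
        rw [lintegral_mul_const _ ((hg _).const_mul _), lintegral_const_mul _ (hg _)]
        ring
      _ ≤ ∫⁻ z in C (n + 1 + 1), ∫⁻ x, q x z * g z (y (n + 1 + 1)) ∂μ ∂vol := by
        refine setLIntegral_mono' (hC _) fun z hz => ?_
        refine (setLIntegral_mono' (hC _) fun x hx => ?_).trans (setLIntegral_le_lintegral _ _)
        gcongr
        exact he _ x hx z hz
      _ = _ := by
        rw [unnormFilter_succ hq hQ hg, push, withDensity_apply _ (hC _)]

lemma unnormFilter_one_ne_zero (hq : Measurable (Function.uncurry q))
    (hQ : ∀ x, Q x = vol.withDensity (q x)) (hg : ∀ n, Measurable fun x => g x (y n))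
    (hq0 : ∀ x z, q x z ≠ 0) (hg0 : ∀ n x, g x (y n) ≠ 0) {A : Set X} (hA : MeasurableSet A)
    (hA0 : vol A ≠ 0) (ν : Measure X) [SFinite ν] [NeZero ν] :
    unnormFilter Q g ν y 1 A ≠ 0 := by
  have hpos : ∀ (μ : Measure X) {φ : X → ℝ≥0∞}, Measurable φ → (∀ x, φ x ≠ 0) →
      ∀ B, μ B ≠ 0 → ∫⁻ x in B, φ x ∂μ ≠ 0 := fun μ φ hφ h0 B hB => by
    have hsupp : Function.support φ = Set.univ := Set.eq_univ_of_forall h0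
    rw [← pos_iff_ne_zero, lintegral_pos_iff_support hφ, hsupp, Measure.restrict_apply .univ,
      Set.univ_inter]
    exact pos_iff_ne_zero.2 hB
  have hqz : ∀ z, Measurable fun x => q x z := fun z =>
    hq.comp (measurable_id.prodMk measurable_const)
  rw [unnormFilter_succ hq hQ hg, push, withDensity_apply _ hA]
  refine hpos _ (measurable_push_density (hq.mul ((hg _).comp measurable_snd)) _) (fun z => ?_) A
    hA0
  rw [← setLIntegral_univ]
  refine hpos _ ((hqz z).mul_const _) (fun x => mul_ne_zero (hq0 _ _) (hg0 _ _)) _ ?_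
  rw [unnormFilter, withDensity_apply _ .univ]
  exact hpos ν (hg 0) (hg0 0) _ (NeZero.ne _)

end LowerBound

/-! ### Exponential rates -/

lemma limsup_log_div_neg {t : ℕ → ℝ≥0∞} {K κ : ℝ≥0∞} (hK : K ≠ ∞) (hκ : κ < 1)
    (h : ∀ᶠ n in atTop, t n ≤ K * κ ^ (n / 4)) :
    limsup (fun n : ℕ => ENNReal.log (t n) / (n : EReal)) atTop < 0 := by
  obtain ⟨a, ha0, ha1, hκa⟩ : ∃ a : ℝ, 0 < a ∧ a < 1 ∧ κ ≤ ENNReal.ofReal a := by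
    obtain ⟨b, hb, hb1⟩ := exists_between hκ
    have hbt : b ≠ ∞ := (hb1.trans ENNReal.one_lt_top).ne
    refine ⟨b.toReal, ENNReal.toReal_pos hb.ne_bot hbt, ?_, ?_⟩
    · simpa using (ENNReal.toReal_lt_toReal hbt ENNReal.one_ne_top).2 hb1
    · rw [ENNReal.ofReal_toReal hbt]; exact hb.le
  set B : ℝ := K.toReal + 1 with hB
  have hB0 : 0 < B := by positivity
  have hKB : K ≤ ENNReal.ofReal B :=
    (ENNReal.le_ofReal_iff_toReal_le hK hB0.le).2 (by linarith)
  have hla : Real.log a < 0 := Real.log_neg ha0 ha1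
  set s : ℝ := Real.log a / 8 with hs
  have hev : ∀ᶠ n : ℕ in atTop, Real.log B - 3 * Real.log a / 4 ≤ -s * n :=
    (tendsto_natCast_atTop_atTop.const_mul_atTop (by linarith : 0 < -s)).eventually_ge_atTop _
  have hle : ∀ᶠ n : ℕ in atTop, ENNReal.log (t n) / (n : EReal) ≤ (s : EReal) := by
    filter_upwards [h, hev, eventually_gt_atTop 0] with n hn hn' hpos
    have hreal : B * a ^ (n / 4) ≤ Real.exp (s * n) := by
      have hfloor : (n : ℝ) - 3 ≤ 4 * ((n / 4 : ℕ) : ℝ) := by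
        have : n ≤ 4 * (n / 4) + 3 := by omega
        have : (n : ℝ) ≤ 4 * ((n / 4 : ℕ) : ℝ) + 3 := by exact_mod_cast this
        linarith
      rw [← Real.log_le_iff_le_exp (by positivity), Real.log_mul hB0.ne' (by positivity),
        Real.log_pow]
      nlinarith
    have ht : t n ≤ ENNReal.ofReal (Real.exp (s * n)) := by
      refine hn.trans ((mul_le_mul' hKB (pow_le_pow_left' hκa _)).trans ?_)
      rw [← ENNReal.ofReal_pow ha0.le, ← ENNReal.ofReal_mul hB0.le]
      exact ENNReal.ofReal_le_ofReal hreal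
    rw [EReal.div_le_iff_le_mul (by exact_mod_cast hpos) (EReal.natCast_ne_top n)]
    refine (ENNReal.log_le_log ht).trans_eq ?_
    rw [ENNReal.log_ofReal_of_pos (Real.exp_pos _), Real.log_exp, mul_comm s]
    norm_cast
  refine (limsup_le_of_le (by isBoundedDefault) hle).trans_lt ?_
  have : s < 0 := by rw [hs]; linarith
  exact_mod_cast this

section Rate

variable {X Y : Type*} [MeasurableSpace X] {vol : Measure X} [SFinite vol]
  {q : X → X → ℝ≥0∞} {C : ℕ → Set X} {Q : Kernel X X} [IsMarkovKernel Q]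
  {g : X → Y → ℝ≥0∞} {y : ℕ → Y}

/-- Forgetting at an exponential rate along a fixed sequence of observations. The masses of the two
unnormalised filters decrease at most like `c ^ n`, the penalty `θ` for bad transitions is small
enough to compensate for this, and at least half of the times are helpful. -/
theorem limsup_log_tvDist_filterDist_neg (hq : Measurable (Function.uncurry q))
    (hQ : ∀ x, Q x = vol.withDensity (q x)) (hg : ∀ n, Measurable fun x => g x (y n))
    (hC : ∀ n, MeasurableSet (C n)) {V : ℝ≥0∞} (hV1 : 1 ≤ V) (hVt : V ≠ ∞)
    (hV : ∀ n x, g x (y n) ≤ V) {θ M e : ℝ≥0∞} (hθ0 : θ ≠ 0) (hθ : θ ≤ 1)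
    (hM : M ≠ ∞) (he0 : e ≠ 0) (heM : e ≤ M)
    (hout : ∀ n, ∀ z ∉ C n, g z (y n) ≤ θ ^ 2)
    (htail : ∀ x, ∫⁻ z, {z | M < q x z}.indicator (q x) z ∂vol ≤ θ)
    (u : ℕ → Prop) [DecidablePred u]
    (hu : ∀ n, u n → ∀ x ∈ C n, ∀ z ∈ C (n + 1), e ≤ q x z)
    (hcount : ∀ᶠ n in atTop, n ≤ 2 * Nat.count u n)
    {c : ℝ≥0∞} (hc0 : c ≠ 0) (hc1 : c ≤ 1) (hθc : θ * (4 * V ^ 2 / c ^ 2) ^ 4 ≤ 2⁻¹)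
    (ν ν' : Measure X) [IsProbabilityMeasure ν] [IsProbabilityMeasure ν']
    {c₀ c₀' : ℝ≥0∞} (hc₀ : c₀ ≠ 0) (hc₀' : c₀' ≠ 0)
    (hlow : ∀ᶠ n in atTop, c₀ * c ^ n ≤ unnormFilter Q g ν y n Set.univ)
    (hlow' : ∀ᶠ n in atTop, c₀' * c ^ n ≤ unnormFilter Q g ν' y n Set.univ) :
    limsup (fun m : ℕ => ENNReal.log (tvDist (filterDist Q g ν y m) (filterDist Q g ν' y m)) /
      (m : EReal)) atTop < 0 := by
  have hM0 : M ≠ 0 := fun h => he0 (le_zero_iff.1 (h ▸ heM))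
  have heM1 : (e / M) ^ 2 ≤ 1 := pow_le_one' (ENNReal.div_le_of_le_mul (by simpa using heM)) 2
  have hpos : (e / M) ^ 2 ≠ 0 := pow_ne_zero 2 (ENNReal.div_ne_zero.2 ⟨he0, hM⟩)
  set ρ : ℝ≥0∞ := 1 - (e / M) ^ 2 with hρ
  have hρ1 : ρ < 1 := ENNReal.sub_lt_self ENNReal.one_ne_top one_ne_zero hpos
  have hρe : ρ + (e / M) ^ 2 = 1 := tsub_add_cancel_of_le heM1
  set Γ : ℝ≥0∞ := 4 * V ^ 2 / c ^ 2 with hΓ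
  have hct : c ^ 2 ≠ ∞ := ((pow_le_one' hc1 2).trans_lt ENNReal.one_lt_top).ne
  have hc20 : c ^ 2 ≠ 0 := pow_ne_zero 2 hc0
  have hV4 : 1 ≤ 4 * V ^ 2 := one_le_mul (by norm_num) (one_le_pow₀ hV1)
  have hΓ1 : 1 ≤ Γ := by
    rw [hΓ, ENNReal.le_div_iff_mul_le (.inl hc20) (.inl hct), one_mul]
    exact (pow_le_one' hc1 2).trans hV4
  have hΓt : Γ ≠ ∞ := ENNReal.div_ne_top (by finiteness) hc20
  set B : ℝ≥0∞ := θ⁻¹ * V ^ 2 with hB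
  have hBt : B ≠ ∞ := ENNReal.mul_ne_top (ENNReal.inv_ne_top.2 hθ0) (by finiteness)
  refine limsup_log_div_neg (K := 1 + Γ ^ 3 * B * (c₀ * c₀')⁻¹) (κ := max ρ 2⁻¹) ?_ ?_ ?_
  · have : (c₀ * c₀')⁻¹ ≠ ∞ := ENNReal.inv_ne_top.2 (mul_ne_zero hc₀ hc₀')
    finiteness
  · exact max_lt hρ1 (ENNReal.inv_lt_one.2 (by norm_num))
  · filter_upwards [hcount, hlow, hlow'] with n hn hl hl'
    have hcn : c ^ n ≠ 0 := pow_ne_zero n hc0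
    have h0 : unnormFilter Q g ν y n Set.univ ≠ 0 := fun h =>
      mul_ne_zero hc₀ hcn (le_zero_iff.1 (h ▸ hl))
    have h0' : unnormFilter Q g ν' y n Set.univ ≠ 0 := fun h =>
      mul_ne_zero hc₀' hcn (le_zero_iff.1 (h ▸ hl'))
    have hD : c₀ * c₀' * (c ^ 2) ^ n ≤
        unnormFilter Q g ν y n Set.univ * unnormFilter Q g ν' y n Set.univ := by
      calc c₀ * c₀' * (c ^ 2) ^ n = (c₀ * c ^ n) * (c₀' * c ^ n) := by ring
        _ ≤ _ := by gcongr
    refine (tvDist_filterDist_le hq hQ hg hC hV1 hVt hV hθ0 hθ hM hM0 hρe hout htail u hu ν ν' n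
      (n / 4) h0 h0').trans ?_
    rw [add_mul, one_mul]
    refine add_le_add ?_ ?_
    · calc ρ ^ (Nat.count u n - n / 4) ≤ ρ ^ (n / 4) :=
            pow_le_pow_right_of_le_one' hρ1.le (by omega)
        _ ≤ _ := pow_le_pow_left' (le_max_left _ _) _
    · have hct' : (c ^ 2) ^ n ≠ ∞ := by finiteness
      have hc20' : (c ^ 2) ^ n ≠ 0 := pow_ne_zero n hc20
      calc _ ≤ θ ^ (n / 4) * ((4 * V ^ 2) ^ n * B) / (c₀ * c₀' * (c ^ 2) ^ n) := by gcongr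
        _ = θ ^ (n / 4) * ((4 * V ^ 2) ^ n * ((c ^ 2) ^ n)⁻¹) * (B * (c₀ * c₀')⁻¹) := by
          rw [ENNReal.div_eq_inv_mul, ENNReal.mul_inv (.inr hct') (.inr hc20')]
          ring
        _ = θ ^ (n / 4) * Γ ^ n * (B * (c₀ * c₀')⁻¹) := by
          rw [hΓ, ENNReal.div_eq_inv_mul, mul_pow, ENNReal.inv_pow]
          ring
        _ = (θ * Γ ^ 4) ^ (n / 4) * Γ ^ (n % 4) * (B * (c₀ * c₀')⁻¹) := by
          conv_lhs => rw [← Nat.div_add_mod n 4, pow_add, pow_mul]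
          have : (4 * (n / 4) + n % 4) / 4 = n / 4 := by omega
          rw [this]
          ring
        _ ≤ (max ρ 2⁻¹) ^ (n / 4) * Γ ^ 3 * (B * (c₀ * c₀')⁻¹) := by
          gcongr
          · exact hθc.trans (le_max_right _ _)
          · omega
        _ = _ := by ring

end Rate

/-! ### A law of large numbers for functions of successive noises -/

section LLN

lemma comap_prod_eq_generateFrom {Ω α β : Type*} [MeasurableSpace α] [MeasurableSpace β]
    (φ : Ω → α × β) : MeasurableSpace.comap φ Prod.instMeasurableSpace =
      MeasurableSpace.generateFrom {s | ∃ t ∈ Set.image2 (· ×ˢ ·) {s : Set α | MeasurableSet s}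
        {t : Set β | MeasurableSet t}, φ ⁻¹' t = s} := by
  rw [← generateFrom_prod, MeasurableSpace.comap_generateFrom]
  rfl

variable {Ω : Type*} [MeasurableSpace Ω] {P : Measure Ω}

lemma indepFun_prodMk_of_indepFun [IsProbabilityMeasure P] {α₁ α₂ β₁ β₂ : Type*}
    [MeasurableSpace α₁] [MeasurableSpace α₂] [MeasurableSpace β₁] [MeasurableSpace β₂]
    {a₁ : Ω → α₁} {a₂ : Ω → α₂} {b₁ : Ω → β₁}
    {b₂ : Ω → β₂} (ha₁ : Measurable a₁) (ha₂ : Measurable a₂) (hb₁ : Measurable b₁)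
    (hb₂ : Measurable b₂) (ha : IndepFun a₁ a₂ P) (hb : IndepFun b₁ b₂ P)
    (hab : IndepFun (fun ω => (a₁ ω, a₂ ω)) (fun ω => (b₁ ω, b₂ ω)) P) :
    IndepFun (fun ω => (a₁ ω, b₁ ω)) (fun ω => (a₂ ω, b₂ ω)) P := by
  have h1 : IndepFun a₁ b₁ P := hab.comp measurable_fst measurable_fst
  have h2 : IndepFun a₂ b₂ P := hab.comp measurable_snd measurable_snd
  rw [IndepFun_iff_Indep, comap_prod_eq_generateFrom, comap_prod_eq_generateFrom]
  refine IndepSets.indep' ?_ ?_ (isPiSystem_prod.comap _) (isPiSystem_prod.comap _) ?_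
  · rintro _ ⟨_, ⟨s, hs, t, ht, rfl⟩, rfl⟩
    exact (ha₁.prodMk hb₁) (hs.prod ht)
  · rintro _ ⟨_, ⟨s, hs, t, ht, rfl⟩, rfl⟩
    exact (ha₂.prodMk hb₂) (hs.prod ht)
  · rw [IndepSets_iff]
    rintro _ _ ⟨_, ⟨s, hs, t, ht, rfl⟩, rfl⟩ ⟨_, ⟨s', hs', t', ht', rfl⟩, rfl⟩
    have e0 : (fun ω => (a₁ ω, b₁ ω)) ⁻¹' s ×ˢ t ∩ (fun ω => (a₂ ω, b₂ ω)) ⁻¹' s' ×ˢ t' =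
        (fun ω => (a₁ ω, a₂ ω)) ⁻¹' s ×ˢ s' ∩ (fun ω => (b₁ ω, b₂ ω)) ⁻¹' t ×ˢ t' := by
      ext ω; simp only [Set.mem_inter_iff, Set.mem_preimage, Set.mem_prod]; tauto
    rw [e0, hab.measure_inter_preimage_eq_mul _ _ (hs.prod hs') (ht.prod ht')]
    simp only [Set.mk_preimage_prod]
    rw [ha.measure_inter_preimage_eq_mul _ _ hs hs', hb.measure_inter_preimage_eq_mul _ _ ht ht',
      h1.measure_inter_preimage_eq_mul _ _ hs ht, h2.measure_inter_preimage_eq_mul _ _ hs' ht']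
    ring

/-- For a sequence of nonnegative variables with the same law and finite mean, in which variables
that are not neighbours are independent, the partial sums grow at most linearly. -/
lemma exists_sum_le_of_oneDependent {W : ℕ → Ω → ℝ≥0∞} (hid : ∀ i, IdentDistrib (W i) (W 0) P P)
    (hind : ∀ i j, i + 1 < j → IndepFun (W i) (W j) P) (hint : ∫⁻ ω, W 0 ω ∂P ≠ ∞) :
    ∃ L : ℝ, 0 ≤ L ∧ ∀ᵐ ω ∂P, (∀ i, W i ω ≠ ∞) ∧
      ∀ᶠ n : ℕ in atTop, ∑ i ∈ Finset.range n, (W i ω).toReal ≤ L * n := by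
  have hind' : ∀ i j, i + 1 < j → IndepFun (fun ω => (W i ω).toReal) (fun ω => (W j ω).toReal) P :=
    fun i j hij => (hind i j hij).comp ENNReal.measurable_toReal ENNReal.measurable_toReal
  have hid' : ∀ i j, IdentDistrib (fun ω => (W i ω).toReal) (fun ω => (W j ω).toReal) P P :=
    fun i j => ((hid i).trans (hid j).symm).comp ENNReal.measurable_toReal
  have hI : ∀ i, Integrable (fun ω => (W i ω).toReal) P := fun i =>
    (hid' i 0).integrable_iff.2 (integrable_toReal_of_lintegral_ne_top
      (hid 0).aemeasurable_fst hint)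
  have hfin : ∀ i, ∀ᵐ ω ∂P, W i ω ≠ ∞ := fun i => by
    have h := ae_lt_top' (hid i).aemeasurable_fst ((hid i).lintegral_eq ▸ hint)
    filter_upwards [h] with ω hω using hω.ne
  set m := ∫ ω, (W 0 ω).toReal ∂P with hm
  have hm0 : 0 ≤ m := integral_nonneg fun _ => ENNReal.toReal_nonneg
  -- The subsequences of even and of odd indices are pairwise independent.
  have hlaw : ∀ r : ℕ, ∀ᵐ ω ∂P, ∀ᶠ n : ℕ in atTop,
      ∑ i ∈ Finset.range n, (W (2 * i + r) ω).toReal ≤ (m + 1) * n := by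
    intro r
    have hslln := strong_law_ae_real (fun i ω => (W (2 * i + r) ω).toReal) (hI _)
      (fun i j hij => by
        rcases Nat.lt_or_gt_of_ne hij with h | h
        · exact hind' _ _ (by omega)
        · exact (hind' _ _ (by omega)).symm) (fun i => hid' _ _)
    have hmean : ∫ ω, (W (2 * 0 + r) ω).toReal ∂P = m := (hid' _ 0).integral_eq
    rw [hmean] at hslln
    filter_upwards [hslln] with ω hω
    filter_upwards [hω.eventually_le_const (lt_add_one m), eventually_gt_atTop 0] with n hn hpos
    rwa [div_le_iff₀ (by exact_mod_cast hpos)] at hn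
  refine ⟨2 * (m + 1), by positivity, ?_⟩
  filter_upwards [ae_all_iff.2 hfin, hlaw 0, hlaw 1] with ω hω h0 h1
  refine ⟨hω, ?_⟩
  filter_upwards [h0, h1] with n hn0 hn1
  have hsplit : ∀ n, ∑ i ∈ Finset.range (2 * n), (W i ω).toReal =
      ∑ i ∈ Finset.range n, (W (2 * i + 0) ω).toReal +
        ∑ i ∈ Finset.range n, (W (2 * i + 1) ω).toReal := fun n => by
    induction n with
    | zero => simp
    | succ n ih =>
      rw [show 2 * (n + 1) = 2 * n + 1 + 1 by ring, Finset.sum_range_succ, Finset.sum_range_succ,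
        ih, Finset.sum_range_succ, Finset.sum_range_succ]
      ring_nf
  calc ∑ i ∈ Finset.range n, (W i ω).toReal ≤ ∑ i ∈ Finset.range (2 * n), (W i ω).toReal :=
        Finset.sum_le_sum_of_subset_of_nonneg (Finset.range_mono (by omega))
          fun _ _ _ => ENNReal.toReal_nonneg
    _ ≤ _ := by rw [hsplit]; linarith

lemma exists_sum_le_of_iid [IsProbabilityMeasure P] {A B : Type*} [MeasurableSpace A]
    [MeasurableSpace B] {ζ : ℕ → Ω → A} {ε : ℕ → Ω → B} (hζ : ∀ k, Measurable (ζ k))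
    (hε : ∀ k, Measurable (ε k))
    (hζl : ∀ k, IdentDistrib (ζ k) (ζ 0) P P) (hεl : ∀ k, IdentDistrib (ε k) (ε 0) P P)
    (hζi : iIndepFun ζ P) (hεi : iIndepFun ε P)
    (hind : IndepFun (fun ω k => ζ k ω) (fun ω k => ε k ω) P)
    {ψ : A × B × B → ℝ≥0∞} (hψ : Measurable ψ)
    (hint : ∫⁻ ω, ψ (ζ 1 ω, ε 0 ω, ε 1 ω) ∂P ≠ ∞) :
    ∃ L : ℝ, 0 ≤ L ∧ ∀ᵐ ω ∂P, (∀ i, ψ (ζ (i + 1) ω, ε i ω, ε (i + 1) ω) ≠ ∞) ∧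
      ∀ᶠ n : ℕ in atTop,
        ∑ i ∈ Finset.range n, (ψ (ζ (i + 1) ω, ε i ω, ε (i + 1) ω)).toReal ≤ L * n := by
  have hζε : ∀ i, IndepFun (ζ (i + 1)) (fun ω => (ε i ω, ε (i + 1) ω)) P := fun i =>
    hind.comp (φ := fun x : ℕ → A => x (i + 1)) (ψ := fun x : ℕ → B => (x i, x (i + 1)))
      (by fun_prop) (by fun_prop)
  refine exists_sum_le_of_oneDependent (W := fun i ω => ψ (ζ (i + 1) ω, ε i ω, ε (i + 1) ω))
    (fun i => ?_) (fun i j hij => ?_) hint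
  · refine IdentDistrib.comp (IdentDistrib.prodMk ((hζl _).trans (hζl _).symm) ?_ (hζε i)
      (hζε 0)) hψ
    exact IdentDistrib.prodMk (hεl i) ((hεl (i + 1)).trans (hεl 1).symm)
      (hεi.indepFun (Nat.succ_ne_self i).symm) (hεi.indepFun zero_ne_one)
  · refine IndepFun.comp (indepFun_prodMk_of_indepFun (hζ _) (hζ _) ((hε _).prodMk (hε _))
      ((hε _).prodMk (hε _)) (hζi.indepFun (by omega)) (hεi.indepFun_prodMk_prodMk hε i (i + 1) j
        (j + 1) (by omega) (by omega) (by omega) (by omega)) ?_) hψ hψ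
    exact hind.comp (φ := fun x : ℕ → A => (x (i + 1), x (j + 1)))
      (ψ := fun x : ℕ → B => ((x i, x (i + 1)), (x j, x (j + 1)))) (by fun_prop) (by fun_prop)

end LLN

/-! ### The state-space model -/

section Model

variable {n p : ℕ}

lemma gammaMinus_antitone (γ : E n → ℝ) : Antitone (gammaMinus γ) := fun _ _ h =>
  le_iInf₂ fun s hs => iInf₂_le s (hs.trans h)

/-- `|Z_1|` is almost surely finite, and `|Z_1| + ⋯ + |Z_m|` grows at most linearly. -/
lemma exists_sum_zVar_le {Ω : Type*} [MeasurableSpace Ω] {P : Measure Ω} [IsProbabilityMeasure P]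
    {f : E n → E n} {h : E n → E p} {γ : E n → ℝ} {v : E p → ℝ}
    {ζ : ℕ → Ω → E n} {ε : ℕ → Ω → E p} {X : ℕ → Ω → E n} {Y : ℕ → Ω → E p}
    (hmodel : IsStateSpaceModel P f h γ v ζ ε X Y) (a b₀ b : ℝ≥0) (Δ : ℝ)
    (hZ : ∫⁻ ω, (zVar γ a b₀ b ζ ε Δ 1 ω).abs ∂P < ∞) :
    ∃ L : ℝ, 0 ≤ L ∧ ∀ᵐ ω ∂P, (∀ i, (zVar γ a b₀ b ζ ε Δ (i + 1) ω).abs ≠ ∞) ∧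
      ∀ᶠ m : ℕ in atTop,
        ∑ i ∈ Finset.range m, (zVar γ a b₀ b ζ ε Δ (i + 1) ω).abs.toReal ≤ L * m := by
  have habs : Measurable EReal.abs := EReal.measurable_of_measurable_real (by
    change Measurable fun r : ℝ => ENNReal.ofReal |r|
    fun_prop)
  have hlaw : ∀ {d : ℕ} {η : ℕ → Ω → E d} {w : E d → ℝ}, IsIIDWithDensity P η w →
      ∀ k, IdentDistrib (η k) (η 0) P P := fun hη k =>
    ⟨(hη.measurable k).aemeasurable, (hη.measurable 0).aemeasurable, by rw [hη.law, hη.law]⟩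
  exact exists_sum_le_of_iid
    (ψ := fun x => (-ENNReal.log (gammaMinus γ (2 * (a + 1) * b₀ + (a + 1) * b * Δ +
      a * b * ‖x.2.1‖ + ‖x.1‖ + b * ‖x.2.2‖))).abs)
    hmodel.stateNoise.measurable hmodel.obsNoise.measurable (hlaw hmodel.stateNoise)
    (hlaw hmodel.obsNoise) hmodel.stateNoise.indep hmodel.obsNoise.indep hmodel.indep_noises
    (habs.comp (((gammaMinus_antitone γ).measurable.comp (by fun_prop)).ennreal_log.neg)) hZ.ne

lemma ofReal_exp_neg_le_of_abs {x : ℝ≥0∞} (hx : (-ENNReal.log x).abs ≠ ∞) :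
    ENNReal.ofReal (Real.exp (-(-ENNReal.log x).abs.toReal)) ≤ x := by
  set z := -ENNReal.log x with hz
  have hlog : ENNReal.log x = -z := by rw [hz, neg_neg]
  rw [← ENNReal.log_le_log_iff, ENNReal.log_ofReal_of_pos (Real.exp_pos _), Real.log_exp, hlog]
  clear_value z
  induction z with
  | bot => simp at hx
  | top => simp at hx
  | coe r =>
    rw [EReal.abs_def, ENNReal.toReal_ofReal (abs_nonneg r)]
    exact_mod_cast neg_le_neg (le_abs_self r)

end Model

section ModelBounds

variable {n p : ℕ} {f : E n → E n} {h : E n → E p} {γ : E n → ℝ} {v : E p → ℝ}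

/-- The density of `transition f γ` with respect to Lebesgue measure. -/
noncomputable def transDensity (f : E n → E n) (γ : E n → ℝ) (x z : E n) : ℝ≥0∞ :=
  ENNReal.ofReal (γ (z - f x))

lemma measurable_transDensity (hf : Measurable f) (hγ : Measurable γ) :
    Measurable (Function.uncurry (transDensity f γ)) :=
  (hγ.comp (measurable_snd.sub (hf.comp measurable_fst))).ennreal_ofReal

lemma transition_eq_withDensity (hf : Measurable f) (hγ : Measurable γ) (x : E n) :
    transition f γ x = volume.withDensity (transDensity f γ x) := by
  exact Kernel.withDensity_apply _ (measurable_transDensity hf hγ) x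

lemma isMarkovKernel_transition (hf : Measurable f) (hγ : IsPositiveDensity γ) :
    IsMarkovKernel (transition f γ) := by
  refine ⟨fun x => ⟨?_⟩⟩
  rw [transition_eq_withDensity hf hγ.measurable, withDensity_apply _ .univ,
    Measure.restrict_univ]
  exact (lintegral_sub_right_eq_self (fun z => ENNReal.ofReal (γ z)) (f x)).trans
    hγ.lintegral_eq_one

lemma measurable_likelihood (hh : Measurable h) (hv : Measurable v) (y : E p) :
    Measurable fun x => likelihood h v x y :=
  (hv.comp (measurable_const.sub hh)).ennreal_ofReal

lemma measurableSet_ldSet (hh : Measurable h) (y : E p) (Δ : ℝ) : MeasurableSet (ldSet h y Δ) :=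
  measurableSet_le (hh.sub_const y).norm measurable_const

/-- The integral of the likelihood over `C(y, Δ)` is bounded below uniformly in `y`: as `h` is
uniformly continuous and onto, `C(y, Δ)` contains a ball of a fixed radius. -/
lemma exists_le_lintegral_likelihood (hh : UniformContinuous h) (hsurj : Function.Surjective h)
    (hv : ConditionE2 v) {Δ : ℝ} (hΔ : 0 < Δ) :
    ∃ κ : ℝ≥0∞, κ ≠ 0 ∧ κ ≤ 1 ∧ ∀ y, κ ≤ ∫⁻ x in ldSet h y Δ, likelihood h v x y := by
  obtain ⟨c, hc, hcv⟩ := hv.pos_on_compact (Metric.closedBall 0 Δ) (isCompact_closedBall 0 Δ)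
  obtain ⟨δ, hδ, hball⟩ := Metric.uniformContinuous_iff.1 hh Δ hΔ
  refine ⟨min (ENNReal.ofReal c * volume (Metric.ball (0 : E n) δ)) 1, ?_, min_le_right _ _,
    fun y => (min_le_left _ _).trans ?_⟩
  · have := (Metric.measure_ball_pos volume (0 : E n) hδ).ne'
    have hc' : ENNReal.ofReal c ≠ 0 := (ENNReal.ofReal_pos.2 hc).ne'
    exact (lt_min (pos_iff_ne_zero.2 (mul_ne_zero hc' this)) one_pos).ne'
  · obtain ⟨x₀, rfl⟩ := hsurj y
    have hsub : Metric.ball x₀ δ ⊆ ldSet h (h x₀) Δ := fun x hx => by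
      have := hball hx
      rw [dist_eq_norm] at this
      exact this.le
    calc ENNReal.ofReal c * volume (Metric.ball (0 : E n) δ)
        ≤ ENNReal.ofReal c * volume (ldSet h (h x₀) Δ) := by
          rw [← Measure.addHaar_ball_center volume x₀]
          gcongr
      _ = ∫⁻ _ in ldSet h (h x₀) Δ, ENNReal.ofReal c := by
          rw [setLIntegral_const]
      _ ≤ _ := setLIntegral_mono' (measurableSet_ldSet hh.continuous.measurable _ _) fun x hx => by
          refine ENNReal.ofReal_le_ofReal (hcv _ ?_)
          rw [mem_closedBall_zero_iff, norm_sub_rev]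
          exact hx

lemma exists_likelihood_le_of_notMem_ldSet (hv : Tendsto v (cocompact (E p)) (𝓝 0)) {η : ℝ≥0∞}
    (hη : η ≠ 0) :
    ∃ Δ : ℝ, 0 < Δ ∧ ∀ y, ∀ x ∉ ldSet h y Δ, likelihood h v x y ≤ η := by
  have hlim : Tendsto (fun u => ENNReal.ofReal (v u)) (cocompact (E p)) (𝓝 0) := by
    simpa using ENNReal.tendsto_ofReal hv
  have hev := hlim.eventually_le_const (pos_iff_ne_zero.2 hη)
  rw [← Metric.cobounded_eq_cocompact, hasBasis_cobounded_norm.eventually_iff] at hev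
  obtain ⟨R, -, hR⟩ := hev
  refine ⟨max R 1, by positivity, fun y x hx => hR ?_⟩
  have hlt : max R 1 < ‖h x - y‖ := not_le.1 hx
  rw [norm_sub_rev] at hlt
  exact (le_max_left _ _).trans hlt.le

/-- A transition has a large density with small probability, uniformly in the starting point. The
density `γ` need not be bounded. -/
lemma exists_lintegral_transDensity_large_le (hγ : IsPositiveDensity γ) {θ : ℝ≥0∞} (hθ : θ ≠ 0) :
    ∃ M : ℝ≥0∞, M ≠ ∞ ∧ 1 ≤ M ∧
      ∀ x, ∫⁻ z, {z | M < transDensity f γ x z}.indicator (transDensity f γ x) z ≤ θ := by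
  have hm : Measurable fun s => ENNReal.ofReal (γ s) := hγ.measurable.ennreal_ofReal
  have hlim : Tendsto (fun k : ℕ => ∫⁻ s, {s | (k : ℝ≥0∞) < ENNReal.ofReal (γ s)}.indicator
      (fun s => ENNReal.ofReal (γ s)) s) atTop (𝓝 (∫⁻ _ : E n, 0)) := by
    refine tendsto_lintegral_of_dominated_convergence (fun s => ENNReal.ofReal (γ s))
      (fun k => hm.indicator (measurableSet_lt measurable_const hm))
      (fun k => ae_of_all _ fun s => Set.indicator_le_self _ _ _)
      (by rw [hγ.lintegral_eq_one]; exact ENNReal.one_ne_top) (ae_of_all _ fun s => ?_)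
    obtain ⟨k₀, hk₀⟩ := ENNReal.exists_nat_gt (ENNReal.ofReal_ne_top (r := γ s))
    refine tendsto_const_nhds.congr' ?_
    filter_upwards [eventually_ge_atTop k₀] with k hk
    refine (Set.indicator_of_notMem (fun hlt => ?_) _).symm
    exact absurd (hlt.trans hk₀) (not_lt.2 (by exact_mod_cast hk))
  rw [lintegral_zero] at hlim
  obtain ⟨k, hk, hk1⟩ := ((hlim.eventually_le_const (pos_iff_ne_zero.2 hθ)).and
    (eventually_ge_atTop 1)).exists
  refine ⟨k, ENNReal.natCast_ne_top k, by exact_mod_cast hk1, fun x => ?_⟩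
  exact (lintegral_sub_right_eq_self (fun s => {s | (k : ℝ≥0∞) < ENNReal.ofReal (γ s)}.indicator
      (fun s => ENNReal.ofReal (γ s)) s) (f x)).trans_le hk

lemma ofReal_exp_neg_le_transDensity {Ω : Type*} [MeasurableSpace Ω] {P : Measure Ω}
    {ζ : ℕ → Ω → E n} {ε : ℕ → Ω → E p} {X : ℕ → Ω → E n} {Y : ℕ → Ω → E p}
    (hmodel : IsStateSpaceModel P f h γ v ζ ε X Y) {a b₀ b : ℝ≥0} (hE1 : ConditionE1 f h a b₀ b)
    {Δ : ℝ} {ω : Ω} {i : ℕ} (hZ : (zVar γ a b₀ b ζ ε Δ (i + 1) ω).abs ≠ ∞)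
    {x z : E n} (hx : x ∈ ldSet h (Y i ω) Δ) (hz : z ∈ ldSet h (Y (i + 1) ω) Δ) :
    ENNReal.ofReal (Real.exp (-(zVar γ a b₀ b ζ ε Δ (i + 1) ω).abs.toReal)) ≤
      transDensity f γ x z := by
  refine (ofReal_exp_neg_le_of_abs hZ).trans (iInf₂_le (z - f x) ?_)
  have hnear : ∀ {k : ℕ} {w : E n}, w ∈ ldSet h (Y k ω) Δ →
      ‖w - X k ω‖ ≤ b₀ + b * (Δ + ‖ε k ω‖) := by
    intro k w hw
    refine (hE1.dist_preimages _ _ w (X k ω) rfl rfl).trans ?_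
    have : ‖h w - h (X k ω)‖ ≤ Δ + ‖ε k ω‖ := by
      have e : h w - h (X k ω) = (h w - Y k ω) + ε k ω := by rw [hmodel.obs_eq]; abel
      rw [e]
      exact (norm_add_le _ _).trans (by gcongr; exact hw)
    gcongr
  have e : z - f x = (z - X (i + 1) ω) + (f (X i ω) - f x) + ζ (i + 1) ω := by
    rw [hmodel.state_eq]; abel
  have hlip : ‖f (X i ω) - f x‖ ≤ a * (b₀ + b * (Δ + ‖ε i ω‖)) := by
    refine (hE1.lipschitz.norm_sub_le _ _).trans ?_
    rw [norm_sub_rev]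
    gcongr
    exact hnear hx
  have h3 := hnear hz
  have htri : ‖z - f x‖ ≤ ‖z - X (i + 1) ω‖ + ‖f (X i ω) - f x‖ + ‖ζ (i + 1) ω‖ := by
    rw [e]; exact norm_add₃_le
  have hb₀ : 0 ≤ ((a : ℝ) + 1) * b₀ := by positivity
  rw [Nat.add_sub_cancel]
  linarith

/-- The unnormalised filter decreases at most exponentially when the transition densities between
successive sets `C(y_i, Δ)` are at least `exp (-N i)`, with `N 0 + ⋯ + N (m - 1) ≤ L m`. -/
lemma exists_le_unnormFilter (hf : Measurable f) (hγ : IsPositiveDensity γ) (hh : Measurable h)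
    (hv : IsPositiveDensity v) {y : ℕ → E p} {Δ : ℝ} {κ : ℝ≥0∞} (hκ0 : κ ≠ 0) (hκ1 : κ ≤ 1)
    (hκ : ∀ y, κ ≤ ∫⁻ x in ldSet h y Δ, likelihood h v x y) {N : ℕ → ℝ} (hN0 : ∀ i, 0 ≤ N i)
    (hN : ∀ i, ∀ x ∈ ldSet h (y i) Δ, ∀ z ∈ ldSet h (y (i + 1)) Δ,
      ENNReal.ofReal (Real.exp (-N i)) ≤ transDensity f γ x z)
    {L : ℝ} (hL : ∀ᶠ m : ℕ in atTop, ∑ i ∈ Finset.range m, N i ≤ L * m)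
    (ν : Measure (E n)) [IsProbabilityMeasure ν] :
    ∃ c₀ : ℝ≥0∞, c₀ ≠ 0 ∧ ∀ᶠ m : ℕ in atTop, c₀ * (κ * ENNReal.ofReal (Real.exp (-L))) ^ m ≤
      unnormFilter (transition f γ) (likelihood h v) ν y m Set.univ := by
  have := isMarkovKernel_transition hf hγ
  have hq := measurable_transDensity hf hγ.measurable
  have hQ := transition_eq_withDensity hf hγ.measurable
  have hg : ∀ k, Measurable fun x => likelihood h v x (y k) := fun k =>
    measurable_likelihood hh hv.measurable _
  have hC : ∀ k, MeasurableSet (ldSet h (y k) Δ) := fun k => measurableSet_ldSet hh _ _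
  have hvol : volume (ldSet h (y 1) Δ) ≠ 0 := fun h0 => hκ0 <| le_zero_iff.1 <| by
    have := hκ (y 1)
    rwa [setLIntegral_measure_zero _ _ h0] at this
  have hexp : ∀ m, ∏ i ∈ Finset.range m, ENNReal.ofReal (Real.exp (-N (i + 1))) =
      ENNReal.ofReal (Real.exp (-∑ i ∈ Finset.range m, N (i + 1))) := fun m => by
    rw [← ENNReal.ofReal_prod_of_nonneg (fun _ _ => (Real.exp_pos _).le), ← Real.exp_sum,
      Finset.sum_neg_distrib]
  refine ⟨unnormFilter (transition f γ) (likelihood h v) ν y 1 (ldSet h (y 1) Δ),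
    unnormFilter_one_ne_zero hq hQ hg (fun x z => (ENNReal.ofReal_pos.2 (hγ.pos _)).ne')
      (fun k x => (ENNReal.ofReal_pos.2 (hv.pos _)).ne') (hC 1) hvol ν, ?_⟩
  filter_upwards [hL, eventually_ge_atTop 1] with m hm hm1
  obtain ⟨k, rfl⟩ := Nat.exists_eq_add_of_le' hm1
  refine le_trans ?_ ((prod_le_unnormFilter hq hQ hg hC hN (fun k => hκ (y k)) ν k).trans
    (measure_mono (Set.subset_univ _)))
  rw [Finset.prod_mul_distrib, Finset.prod_const, Finset.card_range, mul_pow, hexp,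
    ← ENNReal.ofReal_pow (Real.exp_pos _).le, ← Real.exp_nat_mul]
  refine mul_le_mul' le_rfl (mul_le_mul' ?_ (ENNReal.ofReal_le_ofReal (Real.exp_le_exp.2 ?_)))
  · exact pow_le_pow_right_of_le_one' hκ1 (Nat.le_succ k)
  · rw [Finset.sum_range_succ'] at hm
    have := hN0 0
    linarith

/-- By Markov's inequality, at least half of the terms of a nonnegative sequence with
averages at most `L` are at most `2 * L + 1`. -/
lemma le_two_mul_count_of_sum_le {N : ℕ → ℝ} (hN0 : ∀ i, 0 ≤ N i) {L : ℝ} (hL : 0 ≤ L) {m : ℕ}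
    (hm : ∑ i ∈ Finset.range m, N i ≤ L * m) [DecidablePred fun i => N i ≤ 2 * L + 1] :
    m ≤ 2 * Nat.count (fun i => N i ≤ 2 * L + 1) m := by
  set T := (Finset.range m).filter fun i => ¬ N i ≤ 2 * L + 1 with hT
  have hcard : Nat.count (fun i => N i ≤ 2 * L + 1) m + T.card = m := by
    rw [Nat.count_eq_card_filter_range, hT, Finset.card_filter_add_card_filter_not,
      Finset.card_range]
  have hsum : T.card * (2 * L + 1) ≤ ∑ i ∈ Finset.range m, N i := by
    rw [← nsmul_eq_mul]
    refine (Finset.card_nsmul_le_sum T N _ fun i hi => ?_).trans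
      (Finset.sum_le_sum_of_subset_of_nonneg (Finset.filter_subset _ _) fun i _ _ => hN0 i)
    exact (not_le.1 (Finset.mem_filter.1 hi).2).le
  have h2 : 2 * T.card ≤ m := by
    by_contra hlt
    have hlt' : (m : ℝ) + 1 ≤ 2 * T.card := by exact_mod_cast not_le.1 hlt
    have : (0 : ℝ) ≤ m := m.cast_nonneg
    nlinarith
  omega

end ModelBounds

end HMMFilter

theorem proposition7 {n p : ℕ} (hpn : p ≤ n)
    {Ω : Type*} [MeasurableSpace Ω] (P : Measure Ω) [IsProbabilityMeasure P]
    (f : HMMFilter.E n → HMMFilter.E n) (h : HMMFilter.E n → HMMFilter.E p)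
    (γ : HMMFilter.E n → ℝ) (v : HMMFilter.E p → ℝ)
    (ζ : ℕ → Ω → HMMFilter.E n) (ε : ℕ → Ω → HMMFilter.E p)
    (X : ℕ → Ω → HMMFilter.E n) (Y : ℕ → Ω → HMMFilter.E p)
    (hmodel : HMMFilter.IsStateSpaceModel P f h γ v ζ ε X Y)
    (a b₀ b : ℝ≥0)
    (hE1 : HMMFilter.ConditionE1 f h a b₀ b)
    (hE2 : HMMFilter.ConditionE2 v)
    (hZ : ∀ Δ : ℝ, 0 < Δ →
      ∫⁻ ω, (HMMFilter.zVar γ a b₀ b ζ ε Δ 1 ω).abs ∂P < ⊤)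
    (ν ν' : Measure (HMMFilter.E n)) [IsProbabilityMeasure ν] [IsProbabilityMeasure ν']
    (Δ : ℝ) (hΔ : 0 < Δ)
    (hν : ∀ᵐ ω ∂P, 0 < ∫⁻ x, HMMFilter.transition f γ x (HMMFilter.ldSet h (Y 1 ω) Δ) ∂ν)
    (hν' : ∀ᵐ ω ∂P, 0 < ∫⁻ x, HMMFilter.transition f γ x (HMMFilter.ldSet h (Y 1 ω) Δ) ∂ν') :
    ∀ᵐ ω ∂P,
      limsup (fun m : ℕ =>
        ENNReal.log (HMMFilter.tvDist
          (HMMFilter.filterDist (HMMFilter.transition f γ) (HMMFilter.likelihood h v) ν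
            (fun k => Y k ω) m)
          (HMMFilter.filterDist (HMMFilter.transition f γ) (HMMFilter.likelihood h v) ν'
            (fun k => Y k ω) m)) / (m : EReal)) atTop < 0 := by
  classical
  open HMMFilter in
  have hf : Measurable f := hE1.lipschitz.continuous.measurable
  have hh : Measurable h := hE1.uniformContinuous.continuous.measurable
  have hγ := hmodel.stateDensity
  have hv := hmodel.obsDensity
  have := isMarkovKernel_transition hf hγ
  obtain ⟨κ, hκ0, hκ1, hκ⟩ := exists_le_lintegral_likelihood hE1.uniformContinuous
    hE1.surjective hE2 hΔ
  obtain ⟨L, hL0, hL⟩ := exists_sum_zVar_le hmodel a b₀ b Δ (hZ Δ hΔ)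
  obtain ⟨V₀, hV₀⟩ := hE2.bounded
  set V : ℝ≥0∞ := max 1 (ENNReal.ofReal V₀) with hV
  have hV1 : 1 ≤ V := le_max_left _ _
  have hVt : V ≠ ∞ := (max_lt ENNReal.one_lt_top ENNReal.ofReal_lt_top).ne
  have hVle : ∀ x y, likelihood h v x y ≤ V := fun x y =>
    (ENNReal.ofReal_le_ofReal (hV₀ _)).trans (le_max_right _ _)
  set c : ℝ≥0∞ := κ * ENNReal.ofReal (Real.exp (-L)) with hc
  have hc0 : c ≠ 0 := mul_ne_zero hκ0 (ENNReal.ofReal_pos.2 (Real.exp_pos _)).ne'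
  have hc1 : c ≤ 1 :=
    mul_le_one' hκ1 (ENNReal.ofReal_le_one.2 (Real.exp_le_one_iff.2 (by linarith)))
  -- The weight of bad transitions is chosen according to the decay rate `c` of the filters.
  set Γ : ℝ≥0∞ := (4 * V ^ 2 / c ^ 2) ^ 4 with hΓ
  have hct : c ≠ ∞ := (hc1.trans_lt ENNReal.one_lt_top).ne
  have hΓt : Γ ≠ ∞ := by
    have : 4 * V ^ 2 / c ^ 2 ≠ ∞ := ENNReal.div_ne_top (by finiteness) (pow_ne_zero 2 hc0)
    finiteness
  set θ : ℝ≥0∞ := min 1 (2⁻¹ / Γ) with hθ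
  have hθ0 : θ ≠ 0 := (lt_min one_pos (ENNReal.div_pos (by simp) hΓt)).ne'
  have hθc : θ * Γ ≤ 2⁻¹ := by
    calc θ * Γ ≤ 2⁻¹ / Γ * Γ := by gcongr; exact min_le_right _ _
      _ ≤ 2⁻¹ := by rw [mul_comm]; exact ENNReal.mul_div_le
  obtain ⟨Δ', hΔ', hout⟩ := exists_likelihood_le_of_notMem_ldSet (h := h) hE2.tendsto_zero
    (pow_ne_zero 2 hθ0)
  obtain ⟨M, hMt, hM1, htail⟩ := exists_lintegral_transDensity_large_le (f := f) hγ hθ0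
  obtain ⟨L', hL'0, hL'⟩ := exists_sum_zVar_le hmodel a b₀ b Δ' (hZ Δ' hΔ')
  filter_upwards [hL, hL'] with ω ⟨hfin, hsum⟩ ⟨hfin', hsum'⟩
  obtain ⟨c₀, hc₀, hlow⟩ := exists_le_unnormFilter hf hγ hh hv hκ0 hκ1 hκ
    (fun i => ENNReal.toReal_nonneg)
    (fun i x hx z hz => ofReal_exp_neg_le_transDensity hmodel hE1 (hfin i) hx hz) hsum ν
  obtain ⟨c₀', hc₀', hlow'⟩ := exists_le_unnormFilter hf hγ hh hv hκ0 hκ1 hκ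
    (fun i => ENNReal.toReal_nonneg)
    (fun i x hx z hz => ofReal_exp_neg_le_transDensity hmodel hE1 (hfin i) hx hz) hsum ν'
  refine limsup_log_tvDist_filterDist_neg (vol := volume) (q := transDensity f γ)
    (C := fun k => ldSet h (Y k ω) Δ') (V := V) (θ := θ) (M := M)
    (e := ENNReal.ofReal (Real.exp (-(2 * L' + 1))))
    (measurable_transDensity hf hγ.measurable) (transition_eq_withDensity hf hγ.measurable)
    (fun k => measurable_likelihood hh hv.measurable _) (fun k => measurableSet_ldSet hh _ _)
    hV1 hVt (fun k x => hVle x _) hθ0 (min_le_left _ _) hMt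
    (ENNReal.ofReal_pos.2 (Real.exp_pos _)).ne' ?_ (fun k => hout _) htail
    (fun i => (zVar γ a b₀ b ζ ε Δ' (i + 1) ω).abs.toReal ≤ 2 * L' + 1) ?_ ?_ hc0 hc1 hθc ν ν'
    hc₀ hc₀' hlow hlow'
  · exact (ENNReal.ofReal_le_one.2 (Real.exp_le_one_iff.2 (by linarith))).trans hM1
  · intro i hi x hx z hz
    refine le_trans ?_ (ofReal_exp_neg_le_transDensity hmodel hE1 (hfin' i) hx hz)
    gcongr
  · filter_upwards [hsum'] with m hm
    exact le_two_mul_count_of_sum_le (fun i => ENNReal.toReal_nonneg) hL'0 hm
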